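/- **Setting.** Let $n,J,L\ge 0$, $m\ge 1$ be integers, $\mathcal Z$ a finite set and $y:\mathcal Z\to\mathcal Y$ a map. For $\zeta\in\mathcal Z$ let $\hat x(\zeta)\in\mathbb R^n$ and let $R(\zeta)\in\mathbb R^{n\times n}$ be positive semidefinite, with positive semidefinite square root $R^{1/2}(\zeta)$. The data $(\zeta_i,x_i)_{i=1}^m$ are independent pairs such that, given $\zeta_i=\zeta$, $x_i\sim\mathcal N(\hat x(\zeta),R(\zeta))$. Let $\hat{\mathbf X}$ and $\tilde{\mathbf X}$ be the $n\times m$ matrices with columns $\hat x(\zeta_i)$ and $x_i-\hat x(\zeta_i)$, and $\mathbf y=(y(\zeta_i))_i$. Let $\mathcal B$ be the space of pairs $\xi=(\mathbf Q,\mathbf P)$ of row block matrices $\mathbf Q=(q(l))_{0\le l<L}$, $\mathbf P=(p(l))_{0\le l<L}$ with $q(l)\in\mathbb R^{n\times J}$, $p(l)\in\mathbb R^{m\times J}$. Differentiable maps $\theta_l,\omega_l$ define $$\theta(l)=\theta_l\big((q(\mu),p(\mu))_{\mu<l};\mathbf y\big)\in\mathbb R^{n\times J},\qquad \omega(l)=\omega_l\big((p(\mu))_{\mu\le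 l},(q(\mu))_{\mu<l};\mathbf y\big)\in\mathbb R^{m\times J},$$ and $\boldsymbol\Theta=(\theta(l))_l$, $\boldsymbol\Omega=(\omega(l))_l$ as functions of $\xi$. Put $$\phi(\xi)=\begin{bmatrix}\frac1m\tilde{\mathbf X}\boldsymbol\Omega\\ \tilde{\mathbf X}^T\boldsymbol\Theta\end{bmatrix},\qquad \rho_0(\xi)=\begin{bmatrix}\frac1m\hat{\mathbf X}\boldsymbol\Omega-\mathbf Q\\ \hat{\mathbf X}^T\boldsymbol\Theta-\mathbf P\end{bmatrix}.$$ For a matrix $\mathbf E$ with $m$ rows, $\mathbf E_\zeta$ is the sub-matrix of the rows $i$ with $\zeta_i=\zeta$, and $[\mathbf E_\zeta]_{\zeta_i=\zeta}$ is the matrix with these sub-matrices in those rows. For $LJ\times LJ$ matrices seen as $L\times L$ arrays of $J\times J$ blocks, $(\cdot)_{\mathrm u}$ and $(\cdot)_{\mathrm U}$ are the block upper triangular parts with and without the diagonal blocks. Fix $\sigma>0$ and $z\in\mathbb R$. Let $A_\theta(\zeta)$, $A_\omega(\zeta)$ be block upper triangular with $$A_\theta(\zeta)^TA_\theta(\zeta)=\boldsymbol\Theta^TR(\zeta)\boldsymbol\Theta+\sigma^2\mathbf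 I,\qquad A_\omega(\zeta)^TA_\omega(\zeta)=\tfrac1m\boldsymbol\Omega_\zeta^T\boldsymbol\Omega_\zeta+\sigma^2\mathbf I,$$ selected in any way as continuous functions of $\boldsymbol\Theta$ and of $\boldsymbol\Omega$, respectively, such that their $l$-th block columns depend only on $\theta(0),\dots,\theta(l)$, respectively on $\omega(0),\dots,\omega(l)$. Let $$\phi'(\xi)=\phi(\xi)+\sigma\begin{bmatrix}\frac1{\sqrt m}\sum_\zeta R^{1/2}(\zeta)\mathbf U_\zeta\\ \mathbf V\end{bmatrix}+\sqrt{\tfrac{1+z^2}{m}}\begin{bmatrix}\sum_\zeta R(\zeta)\boldsymbol\Theta A_\theta^{-1}(\zeta)\big(\boldsymbol\Gamma_\zeta A_\omega(\zeta)\big)_{\mathrm u}\\ \big[\boldsymbol\Omega_\zeta A_\omega^{-1}(\zeta)\big(\boldsymbol\Gamma_\zeta^TA_\theta(\zeta)\big)_{\mathrm U}\big]_{\zeta_i=\zeta}\end{bmatrix},$$ where $\mathbf U_\zeta\in\mathbb R^{n\times LJ}$, $\mathbf V\in\mathbb R^{m\times LJ}$, $\boldsymbol\Gamma_\zeta\in\mathbb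 R^{LJ\times LJ}$ have independent standard Gaussian entries, jointly independent of the data, and let $$\psi(\xi)=\begin{bmatrix}\sum_\zeta R^{1/2}(\zeta)\frac{\mathbf G_\zeta}{\sqrt m}A_\omega(\zeta)+\sum_\zeta R(\zeta)\boldsymbol\Theta A_\theta^{-1}(\zeta)\Big(\frac{\mathbf H_\zeta^T\boldsymbol\Omega_\zeta}{m}+\frac{\sigma\mathbf W_\zeta+z\boldsymbol\Gamma_\zeta A_\omega(\zeta)}{\sqrt m}\Big)_{\mathrm u}\\ \Big[\mathbf H_\zeta A_\theta(\zeta)+\boldsymbol\Omega_\zeta A_\omega^{-1}(\zeta)\Big(\frac{\mathbf G_\zeta^TR^{1/2}(\zeta)\boldsymbol\Theta+\sigma\mathbf W_\zeta^T+z\boldsymbol\Gamma_\zeta^TA_\theta(\zeta)}{\sqrt m}\Big)_{\mathrm U}\Big]_{\zeta_i=\zeta}\end{bmatrix},$$ where $\mathbf G_\zeta$, $\mathbf H_\zeta$ (of the dimensions of $\boldsymbol\Theta$, $\boldsymbol\Omega_\zeta$) and the $LJ\times LJ$ matrices $\mathbf W_\zeta,\boldsymbol\Gamma_\zeta$ have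 independent standard Gaussian entries, jointly independent of the latent labels $(\zeta_i)$. The two systems may live on different probability spaces, as long as the label vectors $(\zeta_i)_i$ have the same law. **Theorem.** For every $\sigma>0$ and $z\in\mathbb R$, each of the equations $\psi(\xi)+\rho_0(\xi)=0$ and $\phi'(\xi)+\rho_0(\xi)=0$ has, for every realization, exactly one solution in $\mathcal B$, denoted $\xi_\psi$ and $\xi'_\phi$ respectively, and $\xi_\psi$ and $\xi'_\phi$ have identical distributions. In other words, for every measurable $h:\mathcal B\to\mathbb R$, $h(\xi_\psi)$ is integrable if and only if $h(\xi'_\phi)$ is, and then $$\mathbb E[h(\xi_\psi)]=\mathbb E[h(\xi'_\phi)].$$ -/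

import Mathlib

open MeasureTheory ProbabilityTheory

noncomputable section

namespace GMTraining

/-- The product (entrywise) σ-algebra on real matrices; for finite index types it is the Borel one. -/
instance instMeasurableSpaceMatrix {ι κ : Type*} : MeasurableSpace (Matrix ι κ ℝ) :=
  inferInstanceAs (MeasurableSpace (ι → κ → ℝ))

/-- Row block matrices with `k` rows and `L` blocks of `J` columns; the column `(l, j)` is the
`j`-th column of the `l`-th block. -/
abbrev BlockRow (k L J : ℕ) : Type := Matrix (Fin k) (Fin L × Fin J) ℝ

/-- Square `LJ × LJ` matrices, seen as `L × L` arrays of `J × J` blocks. -/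
abbrev BlockSq (L J : ℕ) : Type := Matrix (Fin L × Fin J) (Fin L × Fin J) ℝ

/-- The space of pairs `ξ = (Q, P)`. -/
abbrev State (n m L J : ℕ) : Type := BlockRow n L J × BlockRow m L J

/-- The `l`-th block column. -/
def block {ι : Type*} {L J : ℕ} (M : Matrix ι (Fin L × Fin J) ℝ) (l : Fin L) :
    Matrix ι (Fin J) ℝ :=
  M.submatrix id (fun j => (l, j))

/-- The block upper triangular part, diagonal blocks included. -/
def blockUpper {L J : ℕ} (M : BlockSq L J) : BlockSq L J :=
  Matrix.of fun a b => if a.1 ≤ b.1 then M a b else 0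

/-- The strictly block upper triangular part, diagonal blocks excluded. -/
def blockStrictUpper {L J : ℕ} (M : BlockSq L J) : BlockSq L J :=
  Matrix.of fun a b => if a.1 < b.1 then M a b else 0

/-- The sub-matrix `E_k` of the rows `i` whose latent label is `k`. -/
def rowsOf {m : ℕ} {Z κ : Type*} (lab : Fin m → Z) (k : Z) (E : Matrix (Fin m) κ ℝ) :
    Matrix {i : Fin m // lab i = k} κ ℝ :=
  E.submatrix Subtype.val id

/-- The matrix that has the rows of `E k` at the positions `i` with label `k`. -/
def assemble {m : ℕ} {Z κ : Type*} (lab : Fin m → Z)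
    (E : (k : Z) → Matrix {i : Fin m // lab i = k} κ ℝ) : Matrix (Fin m) κ ℝ :=
  Matrix.of fun i c => E (lab i) ⟨i, rfl⟩ c

open scoped Matrix.Norms.Elementwise in
/-- The sequential training algorithm. At step `l` the query `θ(l)` is computed from
`q(μ), p(μ)`, `μ < l`, and then `ω(l)` from `p(μ)`, `μ ≤ l`, and `q(μ)`, `μ < l`
(and from the vector of class labels). -/
structure Algorithm (n m L J : ℕ) (Y : Type*) where
  theta : (l : Fin L) → (Set.Iio l → Matrix (Fin n) (Fin J) ℝ) →
    (Set.Iio l → Matrix (Fin m) (Fin J) ℝ) → (Fin m → Y) → Matrix (Fin n) (Fin J) ℝ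
  omega : (l : Fin L) → (Set.Iic l → Matrix (Fin m) (Fin J) ℝ) →
    (Set.Iio l → Matrix (Fin n) (Fin J) ℝ) → (Fin m → Y) → Matrix (Fin m) (Fin J) ℝ
  differentiable_theta : ∀ l y, Differentiable ℝ
    (fun h : (Set.Iio l → Matrix (Fin n) (Fin J) ℝ) × (Set.Iio l → Matrix (Fin m) (Fin J) ℝ) =>
      theta l h.1 h.2 y)
  differentiable_omega : ∀ l y, Differentiable ℝ
    (fun h : (Set.Iic l → Matrix (Fin m) (Fin J) ℝ) × (Set.Iio l → Matrix (Fin n) (Fin J) ℝ) =>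
      omega l h.1 h.2 y)

/-- The row block matrix `Θ(ξ)` of all `θ(l)`. -/
def Algorithm.Theta {n m L J : ℕ} {Y : Type*} (alg : Algorithm n m L J Y) (y : Fin m → Y)
    (ξ : State n m L J) : BlockRow n L J :=
  Matrix.of fun a c => alg.theta c.1 (fun μ => block ξ.1 μ) (fun μ => block ξ.2 μ) y a c.2

/-- The row block matrix `Ω(ξ)` of all `ω(l)`. -/
def Algorithm.Omega {n m L J : ℕ} {Y : Type*} (alg : Algorithm n m L J Y) (y : Fin m → Y)
    (ξ : State n m L J) : BlockRow m L J :=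
  Matrix.of fun i c => alg.omega c.1 (fun μ => block ξ.2 μ) (fun μ => block ξ.1 μ) y i c.2

/-- Parameters of the Gaussian mixture: the component means and covariances, and the class of
each component. -/
structure Mixture (n : ℕ) (Z Y : Type*) where
  mean : Z → EuclideanSpace ℝ (Fin n)
  cov : Z → Matrix (Fin n) (Fin n) ℝ
  posSemidef_cov : ∀ k, (cov k).PosSemidef
  cls : Z → Y

open scoped MatrixOrder in
/-- The positive semidefinite square root of the covariance of a component. -/
def Mixture.sqrtCov {n : ℕ} {Z Y : Type*} (mix : Mixture n Z Y) (k : Z) :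
    Matrix (Fin n) (Fin n) ℝ :=
  CFC.sqrt (mix.cov k)

/-- The matrix with columns `x i`. -/
def dataMatrix {n m : ℕ} (x : Fin m → EuclideanSpace ℝ (Fin n)) : Matrix (Fin n) (Fin m) ℝ :=
  Matrix.of fun a i => x i a

/-- The matrix with the conditional means of the samples as columns. -/
def Mixture.meanMatrix {n m : ℕ} {Z Y : Type*} (mix : Mixture n Z Y) (lab : Fin m → Z) :
    Matrix (Fin n) (Fin m) ℝ :=
  dataMatrix fun i => mix.mean (lab i)

/-- `V_θ(k) = Θᵀ R(k) Θ + σ² I`. -/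
def overlapTheta {n L J : ℕ} (σ : ℝ) (R : Matrix (Fin n) (Fin n) ℝ) (Θ : BlockRow n L J) :
    BlockSq L J :=
  Θ.transpose * R * Θ + σ ^ 2 • (1 : BlockSq L J)

open scoped Classical in
/-- `V_ω(k) = m⁻¹ Ω_kᵀ Ω_k + σ² I`. -/
def overlapOmega {m L J : ℕ} {Z : Type*} (σ : ℝ) (lab : Fin m → Z) (k : Z)
    (Ω : BlockRow m L J) : BlockSq L J :=
  (1 / (m : ℝ)) • ((rowsOf lab k Ω).transpose * rowsOf lab k Ω) + σ ^ 2 • (1 : BlockSq L J)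

/-- A selection of Cholesky-type factors `A_θ(k)` of `V_θ(k)` and `A_ω(k)` of `V_ω(k)`, as
continuous functions of `Θ` and of `Ω` (for every vector of latent labels). Any selection is
allowed whose `l`-th block column is determined by the block columns `0, …, l` of its argument, as
is the `l`-th leading block of the factored matrix. -/
structure Factors {n : ℕ} {Z Y : Type*} (m L J : ℕ) (mix : Mixture n Z Y) (σ : ℝ) where
  Aθ : Z → BlockRow n L J → BlockSq L J
  Aω : (Fin m → Z) → Z → BlockRow m L J → BlockSq L J
  blockTriangular_θ : ∀ k Θ, (Aθ k Θ).BlockTriangular Prod.fst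
  blockTriangular_ω : ∀ lab k Ω, (Aω lab k Ω).BlockTriangular Prod.fst
  factor_θ : ∀ k Θ, (Aθ k Θ).transpose * Aθ k Θ = overlapTheta σ (mix.cov k) Θ
  factor_ω : ∀ lab k Ω, (Aω lab k Ω).transpose * Aω lab k Ω = overlapOmega σ lab k Ω
  causal_θ : ∀ k Θ Θ' l, (∀ μ ≤ l, block Θ μ = block Θ' μ) →
    block (Aθ k Θ) l = block (Aθ k Θ') l
  causal_ω : ∀ lab k Ω Ω' l, (∀ μ ≤ l, block Ω μ = block Ω' μ) →
    block (Aω lab k Ω) l = block (Aω lab k Ω') l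
  continuous_θ : ∀ k, Continuous (Aθ k)
  continuous_ω : ∀ lab k, Continuous (Aω lab k)

section Processes

variable {n m L J : ℕ} {Z Y : Type*} (mix : Mixture n Z Y) (alg : Algorithm n m L J Y)

/-- The deterministic part `ρ₀` (given the latent labels). -/
def rhoZero (lab : Fin m → Z) (ξ : State n m L J) : State n m L J :=
  let y : Fin m → Y := fun i => mix.cls (lab i)
  let Θ := alg.Theta y ξ
  let Ω := alg.Omega y ξ
  ((1 / (m : ℝ)) • (mix.meanMatrix lab * Ω) - ξ.1, (mix.meanMatrix lab).transpose * Θ - ξ.2)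

/-- The original process `φ`, driven by the centered data `X - X̂`. -/
def phi (lab : Fin m → Z) (x : Fin m → EuclideanSpace ℝ (Fin n)) (ξ : State n m L J) :
    State n m L J :=
  let y : Fin m → Y := fun i => mix.cls (lab i)
  let Θ := alg.Theta y ξ
  let Ω := alg.Omega y ξ
  let Xc := dataMatrix x - mix.meanMatrix lab
  ((1 / (m : ℝ)) • (Xc * Ω), Xc.transpose * Θ)

variable [Fintype Z] {σ : ℝ} (fac : Factors m L J mix σ) (z : ℝ)

/-- The perturbed original process `φ'`. -/
def phiPert (lab : Fin m → Z) (x : Fin m → EuclideanSpace ℝ (Fin n))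
    (U : Z → BlockRow n L J) (V : BlockRow m L J) (Γ : Z → BlockSq L J)
    (ξ : State n m L J) : State n m L J :=
  let y : Fin m → Y := fun i => mix.cls (lab i)
  let Θ := alg.Theta y ξ
  let Ω := alg.Omega y ξ
  let Aθ : Z → BlockSq L J := fun k => fac.Aθ k Θ
  let Aω : Z → BlockSq L J := fun k => fac.Aω lab k Ω
  phi mix alg lab x ξ
    + σ • ((1 / √(m : ℝ)) • ∑ k, mix.sqrtCov k * U k, V)
    + √((1 + z ^ 2) / (m : ℝ)) •
      (∑ k, mix.cov k * Θ * (Aθ k)⁻¹ * blockUpper (Γ k * Aω k),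
        assemble lab fun k =>
          rowsOf lab k Ω * (Aω k)⁻¹ * blockStrictUpper ((Γ k).transpose * Aθ k))

/-- The alternative process `ψ`. The matrices `H_k` are the row sub-matrices of `H`. -/
def psi (lab : Fin m → Z)
    (G : Z → BlockRow n L J) (H : BlockRow m L J) (W Γ : Z → BlockSq L J)
    (ξ : State n m L J) : State n m L J :=
  let y : Fin m → Y := fun i => mix.cls (lab i)
  let Θ := alg.Theta y ξ
  let Ω := alg.Omega y ξ
  let Aθ : Z → BlockSq L J := fun k => fac.Aθ k Θ
  let Aω : Z → BlockSq L J := fun k => fac.Aω lab k Ω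
  (∑ k, mix.sqrtCov k * ((1 / √(m : ℝ)) • G k) * Aω k
      + ∑ k, mix.cov k * Θ * (Aθ k)⁻¹ *
          open scoped Classical in
          blockUpper ((1 / (m : ℝ)) • ((rowsOf lab k H).transpose * rowsOf lab k Ω)
            + (1 / √(m : ℝ)) • (σ • W k + z • (Γ k * Aω k))),
    assemble lab fun k =>
      rowsOf lab k H * Aθ k
        + rowsOf lab k Ω * (Aω k)⁻¹ *
          blockStrictUpper ((1 / √(m : ℝ)) •
            ((G k).transpose * mix.sqrtCov k * Θ + σ • (W k).transpose
              + z • ((Γ k).transpose * Aθ k))))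

end Processes

/-- The law of a matrix with independent standard Gaussian entries. -/
def stdGaussianMatrix (ι κ : Type*) [Fintype ι] [Fintype κ] : Measure (Matrix ι κ ℝ) :=
  (Measure.pi fun _ : ι => Measure.pi fun _ : κ => gaussianReal 0 1 : Measure (ι → κ → ℝ))

/-- The pairs `(ζ_i, x_i)` are independent and, given `ζ_i = k`, the sample `x_i` is Gaussian with
the mean and the covariance of the component `k`. -/
structure IsMixtureSample {n m : ℕ} {Z Y : Type*} [MeasurableSpace Z] (mix : Mixture n Z Y)
    {S : Type*} [MeasurableSpace S] (P : Measure S) (ζ : Fin m → S → Z)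
    (x : Fin m → S → EuclideanSpace ℝ (Fin n)) : Prop where
  measurable_label : ∀ i, Measurable (ζ i)
  measurable_sample : ∀ i, Measurable (x i)
  indep : iIndepFun (fun i s => (ζ i s, x i s)) P
  gaussian : ∀ i k, P (ζ i ⁻¹' {k}) ≠ 0 →
    HasLaw (x i) (multivariateGaussian (mix.mean k) (mix.cov k))
      (ProbabilityTheory.cond P (ζ i ⁻¹' {k}))

end GMTraining

end

/-! The proof combines two independent facts, both for a fixed vector of latent labels.

One-point laws. At a deterministic state `ξ` both processes are linear in centred Gaussian noise, so
the law of the value is determined by the variances of its linear functionals. Pairing the two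
components with test matrices `C`, `D` and moving everything to the adjoint side, the variances
split over the mixture components. For one component, the factorizations of the overlap matrices
cancel all terms but one: the Frobenius product of a strictly block lower triangular matrix with a
block upper triangular one, which is zero. This is `variance_identity`, and it yields
`map_phiPert_eq_map_psi`. The term in `Γ` with weight `1 + z ^ 2` on one side and `z ^ 2` on the
other supplies exactly the missing variance.

From one-point laws to solutions. Each equation says that `ξ` is a fixed point of a map in which
every block, in the order `p(0), q(0), p(1), q(1), …`, depends on earlier blocks only. Such a causal
map has exactly one fixed point, reached after finitely many iterations from any start. For a causal
map with values on a countable grid, uniqueness shows that the fixed point is `x` precisely when `x`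
is sent to itself, and the probability of that event involves the law of the map at the single point
`x`. Hence the law of the fixed point depends on one-point laws alone, and no comparison of joint
laws at several states is needed. Rounding the map to a grid preserves causality, and the rounded
fixed points converge to the true one as the mesh shrinks, by continuity; this is
`map_causalFix_eq`.

Finally the labels are integrated out: given the labels the samples are independent Gaussians,
independent of the added noise (`IsMixtureSample.map_restrict`), and the label vectors of the two
systems have the same law. -/

noncomputable section

namespace GMTraining

/-! ### Fixed points of causal random maps and their laws. -/

section Causal

open Filter Topology

/-- The coordinate `i` of `f v` depends only on the coordinates of `v` of rank less than `r i`. -/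
def IsCausal {ι : Type*} (r : ι → ℕ) (f : (ι → ℝ) → ι → ℝ) : Prop :=
  ∀ v w i, (∀ j, r j < r i → v j = w j) → f v i = f w i

variable {ι : Type*} {r : ι → ℕ} {f : (ι → ℝ) → ι → ℝ}

/-- Each application of `f` settles the coordinates of one more rank, so the starting point is
forgotten. Existence and uniqueness of the fixed point both follow from this. -/
lemma IsCausal.iterate_apply_eq (hf : IsCausal r f) (v w : ι → ℝ) (k : ℕ) (i : ι) (hi : r i < k) :
    f^[k] v i = f^[k] w i := by
  induction k generalizing i with
  | zero => omega
  | succ k ih =>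
    rw [Function.iterate_succ_apply', Function.iterate_succ_apply']
    exact hf _ _ _ fun j hj => ih j (by omega)

lemma IsCausal.comp_coord (hf : IsCausal r f) (ρ : ℝ → ℝ) :
    IsCausal r (fun v i => ρ (f v i)) :=
  fun v w i h => congrArg ρ (hf v w i h)

/-- The index of the cell of the grid of mesh `1 / (k + 1)` that contains `v`. -/
def gridIndex (k : ℕ) (v : ι → ℝ) : ι → ℤ := fun i => ⌊((k : ℝ) + 1) * v i⌋

/-- The point of the grid of mesh `1 / (k + 1)` with the given index. -/
def gridPoint (k : ℕ) (y : ι → ℤ) : ι → ℝ := fun i => (y i : ℝ) / ((k : ℝ) + 1)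

/-- Rounding down to the grid of mesh `1 / (k + 1)`. -/
def gridRound (k : ℕ) (x : ℝ) : ℝ := (⌊((k : ℝ) + 1) * x⌋ : ℝ) / ((k : ℝ) + 1)

lemma gridIndex_gridPoint (k : ℕ) (y : ι → ℤ) : gridIndex k (gridPoint k y) = y := by
  have hk : (0 : ℝ) < (k : ℝ) + 1 := by positivity
  funext i
  simp only [gridIndex, gridPoint]
  rw [mul_div_cancel₀ _ hk.ne', Int.floor_intCast]

lemma measurable_gridIndex (k : ℕ) : Measurable (gridIndex (ι := ι) k) :=
  measurable_pi_lambda _ fun i =>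
    Int.measurable_floor.comp ((measurable_pi_apply i).const_mul _)

variable [Fintype ι]

/-- The fixed point of a causal map. -/
def causalFix (r : ι → ℕ) (f : (ι → ℝ) → ι → ℝ) : ι → ℝ :=
  f^[Finset.univ.sup r + 1] 0

lemma IsCausal.iterate_eq (hf : IsCausal r f) (v : ι → ℝ) :
    f^[Finset.univ.sup r + 1] v = causalFix r f :=
  funext fun i => hf.iterate_apply_eq _ _ _ i
    (Nat.lt_succ_of_le (Finset.le_sup (f := r) (Finset.mem_univ i)))

lemma IsCausal.map_causalFix (hf : IsCausal r f) : f (causalFix r f) = causalFix r f := by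
  conv_rhs => rw [← hf.iterate_eq (f 0)]
  rw [causalFix, ← Function.iterate_succ_apply' f, Function.iterate_succ_apply]

lemma IsCausal.eq_causalFix (hf : IsCausal r f) {v : ι → ℝ} (hv : f v = v) :
    v = causalFix r f := by
  rw [← hf.iterate_eq v, Function.iterate_fixed hv]

lemma IsCausal.gridPoint_gridIndex_causalFix (hf : IsCausal r f) (k : ℕ) :
    gridPoint k (gridIndex k (causalFix r fun v i => gridRound k (f v i))) =
      causalFix r fun v i => gridRound k (f v i) := by
  have hfix := (hf.comp_coord (gridRound k)).map_causalFix
  set s := causalFix r fun v i => gridRound k (f v i)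
  have hs : gridPoint k (gridIndex k (f s)) = s := hfix
  rw [← hs, gridIndex_gridPoint]

/-- The rounded map is still causal, so its fixed point is unique: a grid point is that fixed point
as soon as it is mapped to itself. The right-hand side evaluates `f` at one deterministic point,
which is what lets one-point laws suffice. -/
lemma IsCausal.gridIndex_causalFix_eq_iff (hf : IsCausal r f) (k : ℕ) (y : ι → ℤ) :
    gridIndex k (causalFix r fun v i => gridRound k (f v i)) = y ↔
      gridIndex k (f (gridPoint k y)) = y := by
  have hcau := hf.comp_coord (gridRound k)
  have hfix := hcau.map_causalFix
  have hgrid := hf.gridPoint_gridIndex_causalFix k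
  set s := causalFix r fun v i => gridRound k (f v i)
  have hs : gridPoint k (gridIndex k (f s)) = s := hfix
  constructor
  · intro h
    rw [← h, hgrid, ← gridIndex_gridPoint k (gridIndex k (f s)), hs]
  · intro h
    have : gridPoint k y = s := hcau.eq_causalFix (by
      change gridPoint k (gridIndex k (f (gridPoint k y))) = gridPoint k y
      rw [h])
    rw [← this, gridIndex_gridPoint]

lemma abs_gridRound_sub_le (k : ℕ) (x : ℝ) : |gridRound k x - x| ≤ 1 / ((k : ℝ) + 1) := by
  have hk : (0 : ℝ) < (k : ℝ) + 1 := by positivity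
  have h1 := Int.floor_le (((k : ℝ) + 1) * x)
  have h2 := Int.lt_floor_add_one (((k : ℝ) + 1) * x)
  have : gridRound k x - x = ((⌊((k : ℝ) + 1) * x⌋ : ℝ) - ((k : ℝ) + 1) * x) / ((k : ℝ) + 1) := by
    rw [gridRound]; field_simp
  rw [this, abs_div, abs_of_pos hk]
  gcongr
  rw [abs_le]
  constructor <;> linarith

lemma measurable_gridRound (k : ℕ) : Measurable (gridRound k) := by
  unfold gridRound
  have : Measurable fun x : ℝ => ⌊((k : ℝ) + 1) * x⌋ :=
    Int.measurable_floor.comp (measurable_const_mul _)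
  exact (measurable_from_top.comp this).div_const _

/-- Although the floor is discontinuous, the rounding error is at most the mesh, uniformly in the
argument. -/
lemma tendsto_gridRound {u : ℕ → ℝ} {x : ℝ} (hu : Tendsto u atTop (𝓝 x)) :
    Tendsto (fun k => gridRound k (u k)) atTop (𝓝 x) := by
  have h : Tendsto (fun k => gridRound k (u k) - u k) atTop (𝓝 0) :=
    squeeze_zero_norm (fun k => abs_gridRound_sub_le k (u k))
      tendsto_one_div_add_atTop_nhds_zero_nat
  simpa using h.add hu

/-- The number of iterations that defines the fixed point does not depend on the mesh, so the
rounding errors pass through a fixed finite composition of continuous maps. -/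
lemma tendsto_causalFix_gridRound (hf : Continuous f) :
    Tendsto (fun k => causalFix r fun v i => gridRound k (f v i)) atTop (𝓝 (causalFix r f)) := by
  unfold causalFix
  induction Finset.univ.sup r + 1 with
  | zero => simp
  | succ N ih =>
    simp only [Function.iterate_succ_apply']
    refine tendsto_pi_nhds.2 fun i => tendsto_gridRound ?_
    exact tendsto_pi_nhds.1 ((hf.tendsto _).comp ih) i

variable {α β : Type*} [MeasurableSpace α] [MeasurableSpace β]
  {F : α → (ι → ℝ) → ι → ℝ} {F' : β → (ι → ℝ) → ι → ℝ}

/-- Continuity in the state and measurability in the randomness give joint measurability of `F`,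
which survives iteration. A general `ρ` covers both the rounded map and, with the identity, the map
itself. -/
lemma measurable_causalFix_comp {ρ : ℝ → ℝ} (hρ : Measurable ρ)
    (hc : ∀ a, Continuous (F a)) (hm : ∀ v, Measurable fun a => F a v) :
    Measurable fun a => causalFix r fun v i => ρ (F a v i) := by
  have hF : Measurable (Function.uncurry fun v a => F a v) :=
    measurable_uncurry_of_continuous_of_measurable hc hm
  unfold causalFix
  induction Finset.univ.sup r + 1 with
  | zero => exact measurable_const
  | succ N ih =>
    simp only [Function.iterate_succ_apply']
    exact measurable_pi_lambda _ fun i =>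
      hρ.comp ((measurable_pi_apply i).comp (hF.comp (ih.prodMk measurable_id)))

lemma measurable_causalFix (hc : ∀ a, Continuous (F a)) (hm : ∀ v, Measurable fun a => F a v) :
    Measurable fun a => causalFix r (F a) :=
  measurable_causalFix_comp (ρ := id) measurable_id hc hm

variable {μ : Measure α} {ν : Measure β}

/-- The laws of the fixed points on a grid are determined by the laws of the map at each point of
the grid: the fixed point is `x` if and only if `x` is mapped to itself. -/
lemma map_causalFix_gridRound_eq (hF : ∀ a, IsCausal r (F a)) (hF' : ∀ b, IsCausal r (F' b))
    (hc : ∀ a, Continuous (F a)) (hm : ∀ v, Measurable fun a => F a v)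
    (hc' : ∀ b, Continuous (F' b)) (hm' : ∀ v, Measurable fun b => F' b v)
    (hlaw : ∀ v, μ.map (fun a => F a v) = ν.map (fun b => F' b v)) (k : ℕ) :
    μ.map (fun a => causalFix r fun v i => gridRound k (F a v i)) =
      ν.map (fun b => causalFix r fun v i => gridRound k (F' b v i)) := by
  have hpt : Measurable (gridPoint (ι := ι) k) := measurable_of_countable _
  have hD := measurable_gridIndex (ι := ι) k
  have hM := measurable_causalFix_comp (r := r) (measurable_gridRound k) hc hm
  have hM' := measurable_causalFix_comp (r := r) (measurable_gridRound k) hc' hm'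
  have hη : μ.map (gridIndex k ∘ fun a => causalFix r fun v i => gridRound k (F a v i)) =
      ν.map (gridIndex k ∘ fun b => causalFix r fun v i => gridRound k (F' b v i)) := by
    -- The grid indices form a countable space, so it is enough to compare the masses of points.
    refine Measure.ext_of_singleton fun y => ?_
    rw [Measure.map_apply (hD.comp hM) (measurableSet_singleton _),
      Measure.map_apply (hD.comp hM') (measurableSet_singleton _)]
    have h1 : (gridIndex k ∘ fun a => causalFix r fun v i => gridRound k (F a v i)) ⁻¹' {y} =
        (fun a => F a (gridPoint k y)) ⁻¹' (gridIndex k ⁻¹' {y}) := by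
      ext a; exact (hF a).gridIndex_causalFix_eq_iff k y
    have h2 : (gridIndex k ∘ fun b => causalFix r fun v i => gridRound k (F' b v i)) ⁻¹' {y} =
        (fun b => F' b (gridPoint k y)) ⁻¹' (gridIndex k ⁻¹' {y}) := by
      ext b; exact (hF' b).gridIndex_causalFix_eq_iff k y
    have hS := hD (measurableSet_singleton y)
    rw [h1, h2, ← Measure.map_apply (hm _) hS, ← Measure.map_apply (hm' _) hS, hlaw]
  -- A rounded fixed point lies on the grid and is therefore recovered from its index.
  have e1 : (fun a => causalFix r fun v i => gridRound k (F a v i)) =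
      gridPoint k ∘ (gridIndex k ∘ fun a => causalFix r fun v i => gridRound k (F a v i)) :=
    funext fun a => ((hF a).gridPoint_gridIndex_causalFix k).symm
  have e2 : (fun b => causalFix r fun v i => gridRound k (F' b v i)) =
      gridPoint k ∘ (gridIndex k ∘ fun b => causalFix r fun v i => gridRound k (F' b v i)) :=
    funext fun b => ((hF' b).gridPoint_gridIndex_causalFix k).symm
  rw [e1, e2, ← Measure.map_map hpt (hD.comp hM), ← Measure.map_map hpt (hD.comp hM'), hη]

lemma tendsto_integral_map_causalFix_gridRound [IsFiniteMeasure μ]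
    (hc : ∀ a, Continuous (F a)) (hm : ∀ v, Measurable fun a => F a v)
    (h : BoundedContinuousFunction (ι → ℝ) ℝ) :
    Tendsto (fun k => ∫ v, h v ∂(μ.map fun a => causalFix r fun v i => gridRound k (F a v i)))
      atTop (𝓝 (∫ v, h v ∂(μ.map fun a => causalFix r (F a)))) := by
  have hmk := fun k => measurable_causalFix_comp (r := r) (measurable_gridRound k) hc hm
  have hm0 := measurable_causalFix (r := r) hc hm
  rw [integral_map hm0.aemeasurable h.continuous.aestronglyMeasurable]
  simp_rw [fun k => integral_map (hmk k).aemeasurable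
    (h.continuous.aestronglyMeasurable (μ := μ.map _))]
  refine tendsto_integral_of_dominated_convergence (fun _ => ‖h‖)
    (fun k => (h.continuous.measurable.comp (hmk k)).aestronglyMeasurable)
    (integrable_const _) (fun k => ae_of_all _ fun c => h.norm_coe_le_norm _)
    (ae_of_all _ fun a => ?_)
  exact (h.continuous.tendsto _).comp (tendsto_causalFix_gridRound (hc a))

/-- The law of the fixed point of a continuous causal random map is determined by the laws of the
values of the map at the deterministic points. -/
theorem map_causalFix_eq [IsFiniteMeasure μ] [IsFiniteMeasure ν]
    (hF : ∀ a, IsCausal r (F a)) (hF' : ∀ b, IsCausal r (F' b))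
    (hc : ∀ a, Continuous (F a)) (hm : ∀ v, Measurable fun a => F a v)
    (hc' : ∀ b, Continuous (F' b)) (hm' : ∀ v, Measurable fun b => F' b v)
    (hlaw : ∀ v, μ.map (fun a => F a v) = ν.map (fun b => F' b v)) :
    μ.map (fun a => causalFix r (F a)) = ν.map (fun b => causalFix r (F' b)) := by
  refine ext_of_forall_integral_eq_of_IsFiniteMeasure fun h => ?_
  refine tendsto_nhds_unique (tendsto_integral_map_causalFix_gridRound hc hm h) ?_
  simp_rw [map_causalFix_gridRound_eq hF hF' hc hm hc' hm' hlaw]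
  exact tendsto_integral_map_causalFix_gridRound hc' hm' h

end Causal

/-! ### Agreement of matrices on the leading block columns. -/

section EqBelow

variable {ι κ : Type*} {L J : ℕ} {t : ℕ}

/-- The block columns of index less than `t` of the two matrices are the same. -/
def EqBelow (t : ℕ) (M M' : Matrix ι (Fin L × Fin J) ℝ) : Prop :=
  ∀ i c, (c.1 : ℕ) < t → M i c = M' i c

variable {M M' N N' : Matrix ι (Fin L × Fin J) ℝ} {T T' : BlockSq L J}

lemma EqBelow.refl (M : Matrix ι (Fin L × Fin J) ℝ) : EqBelow t M M := fun _ _ _ => rfl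

lemma EqBelow.mono {s : ℕ} (h : EqBelow t M M') (hs : s ≤ t) : EqBelow s M M' :=
  fun i c hc => h i c (hc.trans_le hs)

lemma EqBelow.add (h : EqBelow t M M') (h' : EqBelow t N N') : EqBelow t (M + N) (M' + N') :=
  fun i c hc => congrArg₂ (· + ·) (h i c hc) (h' i c hc)

lemma EqBelow.smul (h : EqBelow t M M') (a : ℝ) : EqBelow t (a • M) (a • M') :=
  fun i c hc => congrArg (a * ·) (h i c hc)

lemma EqBelow.sum {K : Type*} (s : Finset K) {M M' : K → Matrix ι (Fin L × Fin J) ℝ}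
    (h : ∀ k, EqBelow t (M k) (M' k)) : EqBelow t (∑ k ∈ s, M k) (∑ k ∈ s, M' k) := by
  intro i c hc
  simp only [Matrix.sum_apply]
  exact Finset.sum_congr rfl fun k _ => h k i c hc

lemma EqBelow.mul_left [Fintype ι] (h : EqBelow t M M') (A : Matrix κ ι ℝ) :
    EqBelow t (A * M) (A * M') := by
  intro i c hc
  simp only [Matrix.mul_apply]
  exact Finset.sum_congr rfl fun j _ => by rw [h j c hc]

/-- A block column of a product with a block upper triangular right factor uses only the block
columns of the left factor up to the same index. Triangularity of `T'` suffices because `T` has the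
same columns in the relevant range. -/
lemma EqBelow.mul (h : EqBelow t M M') (hT : EqBelow t T T') (hT' : T'.BlockTriangular Prod.fst) :
    EqBelow t (M * T) (M' * T') := by
  intro i c hc
  simp only [Matrix.mul_apply]
  refine Finset.sum_congr rfl fun d _ => ?_
  rw [hT d c hc]
  by_cases hd : c.1 < d.1
  · rw [hT' hd, mul_zero, mul_zero]
  · rw [h i d (lt_of_le_of_lt (by simpa using hd) hc)]

lemma EqBelow.inv (h : EqBelow t T T') (hT : IsUnit T.det) (hT' : IsUnit T'.det)
    (htri : T'.BlockTriangular Prod.fst) : EqBelow t T⁻¹ T'⁻¹ := by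
  have : Invertible T' := Matrix.invertibleOfIsUnitDet _ hT'
  have htri' := Matrix.blockTriangular_inv_of_blockTriangular htri
  -- The two sides are `T⁻¹` and `T'⁻¹`. Replacing `T'` by `T` in the middle changes nothing below
  -- `t`, and the triangular right factor `T'⁻¹` preserves this.
  have hz : EqBelow t (T⁻¹ * (T' * T'⁻¹)) (T⁻¹ * (T * T'⁻¹)) := by
    rw [← Matrix.mul_assoc, ← Matrix.mul_assoc]
    exact EqBelow.mul (EqBelow.mul_left (fun i c hc => (h i c hc).symm) _) (EqBelow.refl _) htri'
  rwa [Matrix.mul_nonsing_inv _ hT', Matrix.mul_one, ← Matrix.mul_assoc,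
    Matrix.nonsing_inv_mul _ hT, Matrix.one_mul] at hz

lemma blockTriangular_blockUpper (T : BlockSq L J) : (blockUpper T).BlockTriangular Prod.fst :=
  fun _ _ h => if_neg (not_le.2 h)

lemma EqBelow.blockUpper (h : EqBelow t T T') : EqBelow t (blockUpper T) (blockUpper T') := by
  intro i c hc
  simp only [GMTraining.blockUpper, Matrix.of_apply, h i c hc]

/-- Excluding the diagonal blocks gains one index: block column `t` of the product needs only the
columns of `M` before `t`. This is what makes `p(l)` depend on `ω(μ)` with `μ < l` only. -/
lemma EqBelow.mul_blockStrictUpper (h : EqBelow t M M') (hT : EqBelow (t + 1) T T') :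
    EqBelow (t + 1) (M * blockStrictUpper T) (M' * blockStrictUpper T') := by
  intro i c hc
  simp only [Matrix.mul_apply]
  refine Finset.sum_congr rfl fun d _ => ?_
  simp only [blockStrictUpper, Matrix.of_apply, hT d c hc]
  split_ifs with hd
  · rw [h i d (by have : (d.1 : ℕ) < c.1 := hd
                  omega)]
  · rw [mul_zero, mul_zero]

variable {m : ℕ} {Z : Type*} (lab : Fin m → Z)

lemma EqBelow.rowsOf {E E' : BlockRow m L J} (h : EqBelow t E E') (k : Z) :
    EqBelow t (rowsOf lab k E) (rowsOf lab k E') :=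
  fun i c hc => h i.1 c hc

lemma EqBelow.assemble {E E' : (k : Z) → Matrix {i : Fin m // lab i = k} (Fin L × Fin J) ℝ}
    (h : ∀ k, EqBelow t (E k) (E' k)) : EqBelow t (assemble lab E) (assemble lab E') :=
  fun i c hc => h (lab i) ⟨i, rfl⟩ c hc

variable {n : ℕ} {Y : Type*} (alg : Algorithm n m L J Y) (y : Fin m → Y) {ξ ξ' : State n m L J}

lemma EqBelow.block_eq (h : EqBelow t M M') {l : Fin L} (hl : (l : ℕ) < t) :
    block M l = block M' l := by
  ext i j
  exact h i (l, j) hl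

lemma EqBelow.Theta (hQ : EqBelow t ξ.1 ξ'.1) (hP : EqBelow t ξ.2 ξ'.2) :
    EqBelow (t + 1) (alg.Theta y ξ) (alg.Theta y ξ') := by
  intro i c hc
  have hμ : ∀ μ : Set.Iio c.1, ((μ : Fin L) : ℕ) < t := fun μ => by
    have : ((μ : Fin L) : ℕ) < c.1 := μ.2
    omega
  have e1 : (fun μ : Set.Iio c.1 => block ξ.1 μ) = fun μ : Set.Iio c.1 => block ξ'.1 μ :=
    funext fun μ => hQ.block_eq (hμ μ)
  have e2 : (fun μ : Set.Iio c.1 => block ξ.2 μ) = fun μ : Set.Iio c.1 => block ξ'.2 μ :=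
    funext fun μ => hP.block_eq (hμ μ)
  simp only [Algorithm.Theta, Matrix.of_apply, e1, e2]

/-- The separate indices `s` and `t` serve two situations: before `p(s)` is known (`t = s`), and
after it (`t = s + 1`), since `ω(s)` uses `p(s)` but not `q(s)`. -/
lemma EqBelow.Omega {s : ℕ} (hQ : EqBelow s ξ.1 ξ'.1) (hP : EqBelow t ξ.2 ξ'.2) (hts : t ≤ s + 1) :
    EqBelow t (alg.Omega y ξ) (alg.Omega y ξ') := by
  intro i c hc
  have e1 : (fun μ : Set.Iio c.1 => block ξ.1 μ) = fun μ : Set.Iio c.1 => block ξ'.1 μ :=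
    funext fun μ => hQ.block_eq (by
      have : ((μ : Fin L) : ℕ) < c.1 := μ.2
      omega)
  have e2 : (fun μ : Set.Iic c.1 => block ξ.2 μ) = fun μ : Set.Iic c.1 => block ξ'.2 μ :=
    funext fun μ => hP.block_eq (by
      have : ((μ : Fin L) : ℕ) ≤ c.1 := μ.2
      omega)
  simp only [Algorithm.Omega, Matrix.of_apply, e1, e2]

variable {mix : Mixture n Z Y} {σ : ℝ} (fac : Factors m L J mix σ)

lemma EqBelow.Aθ {Θ Θ' : BlockRow n L J} (h : EqBelow t Θ Θ') (k : Z) :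
    EqBelow t (fac.Aθ k Θ) (fac.Aθ k Θ') := by
  intro i c hc
  have := fac.causal_θ k Θ Θ' c.1 fun μ hμ => h.block_eq (lt_of_le_of_lt hμ hc)
  exact congrFun (congrFun this i) c.2

lemma EqBelow.Aω {Ω Ω' : BlockRow m L J} (h : EqBelow t Ω Ω') (k : Z) :
    EqBelow t (fac.Aω lab k Ω) (fac.Aω lab k Ω') := by
  intro i c hc
  have := fac.causal_ω lab k Ω Ω' c.1 fun μ hμ => h.block_eq (lt_of_le_of_lt hμ hc)
  exact congrFun (congrFun this i) c.2

end EqBelow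

/-! ### Invertibility of the factors. -/

section Invertibility

variable {n m L J : ℕ} {Z Y : Type*} {mix : Mixture n Z Y} {σ : ℝ} (fac : Factors m L J mix σ)

lemma isUnit_det_of_transpose_mul_self_posDef {ι : Type*} [Fintype ι] [DecidableEq ι]
    {A : Matrix ι ι ℝ} (h : (A.transpose * A).PosDef) : IsUnit A.det := by
  have := h.det_pos
  rw [Matrix.det_mul, Matrix.det_transpose] at this
  exact isUnit_iff_ne_zero.2 fun h0 => by simp [h0] at this

/-- The summand `σ ^ 2 • 1` makes the overlap matrix positive definite even when the covariance or
`Θ` is degenerate; this is where `σ > 0` enters. -/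
lemma Factors.isUnit_det_Aθ (hσ : 0 < σ) (k : Z) (Θ : BlockRow n L J) :
    IsUnit (fac.Aθ k Θ).det := by
  refine isUnit_det_of_transpose_mul_self_posDef ?_
  rw [fac.factor_θ]
  refine Matrix.PosDef.posSemidef_add ?_ (Matrix.PosDef.one.smul (by positivity))
  simpa using (mix.posSemidef_cov k).conjTranspose_mul_mul_same Θ

lemma Factors.isUnit_det_Aω (hσ : 0 < σ) (lab : Fin m → Z) (k : Z) (Ω : BlockRow m L J) :
    IsUnit (fac.Aω lab k Ω).det := by
  classical
  refine isUnit_det_of_transpose_mul_self_posDef ?_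
  rw [fac.factor_ω]
  refine Matrix.PosDef.posSemidef_add ?_ (Matrix.PosDef.one.smul (by positivity))
  refine Matrix.PosSemidef.smul ?_ (by positivity)
  simpa using Matrix.posSemidef_conjTranspose_mul_self (rowsOf lab k Ω)

lemma EqBelow.mul_inv_Aθ {ι : Type*} {t : ℕ} (hσ : 0 < σ) {M M' : Matrix ι (Fin L × Fin J) ℝ}
    (h : EqBelow t M M') {Θ Θ' : BlockRow n L J} (hΘ : EqBelow t Θ Θ') (k : Z) :
    EqBelow t (M * (fac.Aθ k Θ)⁻¹) (M' * (fac.Aθ k Θ')⁻¹) := by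
  have hu := fac.isUnit_det_Aθ hσ k
  have : Invertible (fac.Aθ k Θ') := Matrix.invertibleOfIsUnitDet _ (hu Θ')
  exact h.mul ((hΘ.Aθ fac k).inv (hu Θ) (hu Θ') (fac.blockTriangular_θ ..))
    (Matrix.blockTriangular_inv_of_blockTriangular (fac.blockTriangular_θ ..))

lemma EqBelow.mul_inv_Aω {ι : Type*} {t : ℕ} (hσ : 0 < σ) {M M' : Matrix ι (Fin L × Fin J) ℝ}
    (h : EqBelow t M M') (lab : Fin m → Z) {Ω Ω' : BlockRow m L J} (hΩ : EqBelow t Ω Ω') (k : Z) :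
    EqBelow t (M * (fac.Aω lab k Ω)⁻¹) (M' * (fac.Aω lab k Ω')⁻¹) := by
  have hu := fac.isUnit_det_Aω hσ lab k
  have : Invertible (fac.Aω lab k Ω') := Matrix.invertibleOfIsUnitDet _ (hu Ω')
  exact h.mul ((hΩ.Aω lab fac k).inv (hu Ω) (hu Ω') (fac.blockTriangular_ω ..))
    (Matrix.blockTriangular_inv_of_blockTriangular (fac.blockTriangular_ω ..))

end Invertibility

/-! ### Causality of the two systems. -/

section StateCausal

variable {n m L J : ℕ} {Z Y : Type*}

/-- In the order `p(0), q(0), p(1), q(1), …` every block of `T ξ` depends on the preceding blocks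
of `ξ` only. -/
def IsStateCausal (T : State n m L J → State n m L J) : Prop :=
  ∀ t ξ ξ', EqBelow t ξ.1 ξ'.1 → EqBelow t ξ.2 ξ'.2 →
    EqBelow (t + 1) (T ξ).2 (T ξ').2 ∧
      (EqBelow (t + 1) ξ.2 ξ'.2 → EqBelow (t + 1) (T ξ).1 (T ξ').1)

lemma IsStateCausal.add {T T' : State n m L J → State n m L J} (h : IsStateCausal T)
    (h' : IsStateCausal T') : IsStateCausal fun ξ => T ξ + T' ξ :=
  fun t ξ ξ' hQ hP => ⟨(h t ξ ξ' hQ hP).1.add (h' t ξ ξ' hQ hP).1,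
    fun hP' => ((h t ξ ξ' hQ hP).2 hP').add ((h' t ξ ξ' hQ hP).2 hP')⟩

variable (mix : Mixture n Z Y) (alg : Algorithm n m L J Y)

/-- The non-trivial part of `ρ₀`, driven by the means of the components. -/
def drift (lab : Fin m → Z) (ξ : State n m L J) : State n m L J :=
  ((1 / (m : ℝ)) • (mix.meanMatrix lab * alg.Omega (fun i => mix.cls (lab i)) ξ),
    (mix.meanMatrix lab).transpose * alg.Theta (fun i => mix.cls (lab i)) ξ)

lemma add_rhoZero_eq_zero_iff (lab : Fin m → Z) (T ξ : State n m L J) :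
    T + rhoZero mix alg lab ξ = 0 ↔ T + drift mix alg lab ξ = ξ := by
  have : rhoZero mix alg lab ξ = drift mix alg lab ξ - ξ := rfl
  rw [this, ← add_sub_assoc, sub_eq_zero]

/-- Used twice: with the matrix of means for the drift, and with the centred data for `φ`. -/
lemma isStateCausal_matrix_mul (lab : Fin m → Z) (X : Matrix (Fin n) (Fin m) ℝ) :
    IsStateCausal fun ξ : State n m L J =>
      ((1 / (m : ℝ)) • (X * alg.Omega (fun i => mix.cls (lab i)) ξ),
        X.transpose * alg.Theta (fun i => mix.cls (lab i)) ξ) :=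
  fun _ _ _ hQ hP => ⟨(EqBelow.Theta alg _ hQ hP).mul_left _,
    fun hP' => ((EqBelow.Omega alg _ hQ hP' le_rfl).mul_left _).smul _⟩

variable [Fintype Z] {σ : ℝ} (fac : Factors m L J mix σ) (z : ℝ) (lab : Fin m → Z)

lemma isStateCausal_phiPert (hσ : 0 < σ) (x : Fin m → EuclideanSpace ℝ (Fin n))
    (U : Z → BlockRow n L J) (V : BlockRow m L J) (Γ : Z → BlockSq L J) :
    IsStateCausal (phiPert mix alg fac z lab x U V Γ) := by
  refine ((isStateCausal_matrix_mul mix alg lab _).add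
    (T' := fun _ => σ • ((1 / √(m : ℝ)) • ∑ k, mix.sqrtCov k * U k, V))
    fun t ξ ξ' _ _ => ⟨EqBelow.refl _, fun _ => EqBelow.refl _⟩).add ?_
  intro t ξ ξ' hQ hP
  have hΘ := EqBelow.Theta alg (fun i => mix.cls (lab i)) hQ hP
  have hΩ := EqBelow.Omega alg (fun i => mix.cls (lab i)) hQ hP (Nat.le_succ t)
  simp only [Prod.smul_mk]
  constructor
  -- At this stage `Ω` is known below `t` only, while `Θ` is known below `t + 1`; the strict
  -- triangular part makes up for the missing block.
  · refine EqBelow.smul (EqBelow.assemble lab fun k => EqBelow.mul_blockStrictUpper ?_ ?_) _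
    · exact (hΩ.rowsOf lab k).mul_inv_Aω fac hσ lab hΩ k
    · exact (hΘ.Aθ fac k).mul_left _
  · intro hP'
    have hΩ' := EqBelow.Omega alg (fun i => mix.cls (lab i)) hQ hP' le_rfl
    refine EqBelow.smul (EqBelow.sum _ fun k => EqBelow.mul ?_ ?_ (blockTriangular_blockUpper _)) _
    · exact (hΘ.mul_left _).mul_inv_Aθ fac hσ hΘ k
    · exact ((hΩ'.Aω lab fac k).mul_left _).blockUpper

lemma isStateCausal_psi (hσ : 0 < σ) (G : Z → BlockRow n L J) (H : BlockRow m L J)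
    (W Γ : Z → BlockSq L J) : IsStateCausal (psi mix alg fac z lab G H W Γ) := by
  intro t ξ ξ' hQ hP
  have hΘ := EqBelow.Theta alg (fun i => mix.cls (lab i)) hQ hP
  have hΩ := EqBelow.Omega alg (fun i => mix.cls (lab i)) hQ hP (Nat.le_succ t)
  simp only [psi]
  constructor
  · refine EqBelow.assemble lab fun k => ((hΘ.Aθ fac k).mul_left _).add
      (EqBelow.mul_blockStrictUpper ((hΩ.rowsOf lab k).mul_inv_Aω fac hσ lab hΩ k) ?_)
    exact (((hΘ.mul_left _).add (EqBelow.refl _)).add (((hΘ.Aθ fac k).mul_left _).smul _)).smul _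
  · intro hP'
    have hΩ' := EqBelow.Omega alg (fun i => mix.cls (lab i)) hQ hP' le_rfl
    refine (EqBelow.sum _ fun k => (hΩ'.Aω lab fac k).mul_left _).add
      (EqBelow.sum _ fun k => EqBelow.mul ((hΘ.mul_left _).mul_inv_Aθ fac hσ hΘ k)
        (EqBelow.blockUpper ?_) (blockTriangular_blockUpper _))
    classical
    exact ((EqBelow.mul_left (hΩ'.rowsOf lab k) _).smul _).add
      (((EqBelow.refl _).add (((hΩ'.Aω lab fac k).mul_left _).smul _)).smul _)

end StateCausal

/-! ### Continuity and measurability of the two processes. -/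

section Continuity

instance instBorelSpaceMatrix {ι κ : Type*} [Countable ι] [Countable κ] :
    BorelSpace (Matrix ι κ ℝ) :=
  inferInstanceAs (BorelSpace (ι → κ → ℝ))

instance instSecondCountableTopologyMatrix {ι κ : Type*} [Countable ι] [Countable κ] :
    SecondCountableTopology (Matrix ι κ ℝ) :=
  inferInstanceAs (SecondCountableTopology (ι → κ → ℝ))

variable {X κ : Type*} [TopologicalSpace X] {n m L J : ℕ} {Z Y : Type*}

lemma continuous_blockUpper : Continuous (blockUpper : BlockSq L J → BlockSq L J) := by
  refine continuous_matrix fun a b => ?_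
  simp only [blockUpper, Matrix.of_apply]
  split_ifs
  · exact continuous_id.matrix_elem a b
  · exact continuous_const

lemma continuous_blockStrictUpper :
    Continuous (blockStrictUpper : BlockSq L J → BlockSq L J) := by
  refine continuous_matrix fun a b => ?_
  simp only [blockStrictUpper, Matrix.of_apply]
  split_ifs
  · exact continuous_id.matrix_elem a b
  · exact continuous_const

lemma continuous_rowsOf (lab : Fin m → Z) (k : Z) :
    Continuous (rowsOf lab k : Matrix (Fin m) κ ℝ → _) :=
  continuous_id.matrix_submatrix _ _

lemma continuous_assemble (lab : Fin m → Z)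
    {E : X → (k : Z) → Matrix {i : Fin m // lab i = k} κ ℝ} (hE : ∀ k, Continuous fun x => E x k) :
    Continuous fun x => assemble lab (E x) :=
  continuous_matrix fun i c => (hE (lab i)).matrix_elem ⟨i, rfl⟩ c

lemma continuous_dataMatrix :
    Continuous (dataMatrix : (Fin m → EuclideanSpace ℝ (Fin n)) → _) := by
  refine continuous_matrix fun a i => ?_
  simp only [dataMatrix, Matrix.of_apply]
  fun_prop

lemma continuous_inv_of_isUnit_det {ι : Type*} [Fintype ι] [DecidableEq ι] {A : X → Matrix ι ι ℝ}
    (hA : Continuous A) (hu : ∀ x, IsUnit (A x).det) : Continuous fun x => (A x)⁻¹ := by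
  simp only [Matrix.inv_def, Ring.inverse_eq_inv']
  exact (hA.matrix_det.inv₀ fun x => (hu x).ne_zero).smul hA.matrix_adjugate

variable (alg : Algorithm n m L J Y) (y : Fin m → Y)

lemma continuous_block {ι : Type*} (l : Fin L) :
    Continuous fun M : Matrix ι (Fin L × Fin J) ℝ => block M l :=
  continuous_id.matrix_submatrix _ _

lemma continuous_Theta : Continuous (alg.Theta y) := by
  refine continuous_matrix fun a c => ?_
  have h1 := (alg.differentiable_theta c.1 y).continuous
  have h2 : Continuous fun ξ : State n m L J =>
      ((fun μ : Set.Iio c.1 => block ξ.1 μ), (fun μ : Set.Iio c.1 => block ξ.2 μ)) :=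
    (continuous_pi fun μ => (continuous_block _).comp continuous_fst).prodMk
      (continuous_pi fun μ => (continuous_block _).comp continuous_snd)
  exact (h1.comp h2).matrix_elem a c.2

lemma continuous_Omega : Continuous (alg.Omega y) := by
  refine continuous_matrix fun a c => ?_
  have h1 := (alg.differentiable_omega c.1 y).continuous
  have h2 : Continuous fun ξ : State n m L J =>
      ((fun μ : Set.Iic c.1 => block ξ.2 μ), (fun μ : Set.Iio c.1 => block ξ.1 μ)) :=
    (continuous_pi fun μ => (continuous_block _).comp continuous_snd).prodMk
      (continuous_pi fun μ => (continuous_block _).comp continuous_fst)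
  exact (h1.comp h2).matrix_elem a c.2

variable (mix : Mixture n Z Y)

lemma continuous_drift (lab : Fin m → Z) : Continuous (drift mix alg lab) :=
  ((continuous_const.matrix_mul (continuous_Omega alg _)).fun_const_smul _).prodMk
    (continuous_const.matrix_mul (continuous_Theta alg _))

variable [Fintype Z] {σ : ℝ} (fac : Factors m L J mix σ) (z : ℝ) (lab : Fin m → Z)

variable (n m L J Z) in
/-- The random inputs of the perturbed original process. -/
abbrev PhiNoise : Type _ :=
  (Fin m → EuclideanSpace ℝ (Fin n)) × (Z → BlockRow n L J) × BlockRow m L J × (Z → BlockSq L J)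

variable (n m L J Z) in
/-- The random inputs of the alternative process. -/
abbrev PsiNoise : Type _ :=
  (Z → BlockRow n L J) × BlockRow m L J × (Z → BlockSq L J) × (Z → BlockSq L J)

/-- Joint continuity in noise and state gives at once continuity in the state for each realization
and measurability in the noise at each state. -/
lemma continuous_phiPert (hσ : 0 < σ) :
    Continuous fun p : PhiNoise n m L J Z × State n m L J =>
      phiPert mix alg fac z lab p.1.1 p.1.2.1 p.1.2.2.1 p.1.2.2.2 p.2 := by
  have hΘ : Continuous fun p : PhiNoise n m L J Z × State n m L J =>
      alg.Theta (fun i => mix.cls (lab i)) p.2 := (continuous_Theta alg _).comp continuous_snd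
  have hΩ : Continuous fun p : PhiNoise n m L J Z × State n m L J =>
      alg.Omega (fun i => mix.cls (lab i)) p.2 := (continuous_Omega alg _).comp continuous_snd
  have hΩk := fun k => (continuous_rowsOf lab k).comp hΩ
  have hAθ := fun k => (fac.continuous_θ k).comp hΘ
  have hAω := fun k => (fac.continuous_ω lab k).comp hΩ
  have hAθi := fun k => continuous_inv_of_isUnit_det (hAθ k) fun _ => fac.isUnit_det_Aθ hσ k _
  have hAωi := fun k => continuous_inv_of_isUnit_det (hAω k) fun _ => fac.isUnit_det_Aω hσ lab k _
  have hX : Continuous fun p : PhiNoise n m L J Z × State n m L J =>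
      dataMatrix p.1.1 - mix.meanMatrix lab :=
    (continuous_dataMatrix.comp (continuous_fst.comp continuous_fst)).sub continuous_const
  have hU : ∀ k, Continuous fun p : PhiNoise n m L J Z × State n m L J => p.1.2.1 k :=
    fun k => by fun_prop
  have hV : Continuous fun p : PhiNoise n m L J Z × State n m L J => p.1.2.2.1 := by fun_prop
  have hΓ : ∀ k, Continuous fun p : PhiNoise n m L J Z × State n m L J => p.1.2.2.2 k :=
    fun k => by fun_prop
  refine ((((hX.matrix_mul hΩ).fun_const_smul _).prodMk (hX.matrix_transpose.matrix_mul hΘ)).add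
    ((((continuous_finsetSum _ fun k _ =>
      continuous_const.matrix_mul (hU k)).fun_const_smul (1 / √(m : ℝ))).prodMk
        hV).fun_const_smul σ)).add
    (((continuous_finsetSum _ fun k _ => ?_).prodMk
      (continuous_assemble lab fun k => ?_)).fun_const_smul _)
  · exact ((continuous_const.matrix_mul hΘ).matrix_mul (hAθi k)).matrix_mul
      (continuous_blockUpper.comp ((hΓ k).matrix_mul (hAω k)))
  · exact ((hΩk k).matrix_mul (hAωi k)).matrix_mul
      (continuous_blockStrictUpper.comp ((hΓ k).matrix_transpose.matrix_mul (hAθ k)))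

lemma continuous_psi (hσ : 0 < σ) :
    Continuous fun p : PsiNoise n m L J Z × State n m L J =>
      psi mix alg fac z lab p.1.1 p.1.2.1 p.1.2.2.1 p.1.2.2.2 p.2 := by
  classical
  have hΘ : Continuous fun p : PsiNoise n m L J Z × State n m L J =>
      alg.Theta (fun i => mix.cls (lab i)) p.2 := (continuous_Theta alg _).comp continuous_snd
  have hΩ : Continuous fun p : PsiNoise n m L J Z × State n m L J =>
      alg.Omega (fun i => mix.cls (lab i)) p.2 := (continuous_Omega alg _).comp continuous_snd
  have hΩk := fun k => (continuous_rowsOf lab k).comp hΩ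
  have hAθ := fun k => (fac.continuous_θ k).comp hΘ
  have hAω := fun k => (fac.continuous_ω lab k).comp hΩ
  have hAθi := fun k => continuous_inv_of_isUnit_det (hAθ k) fun _ => fac.isUnit_det_Aθ hσ k _
  have hAωi := fun k => continuous_inv_of_isUnit_det (hAω k) fun _ => fac.isUnit_det_Aω hσ lab k _
  have hG : ∀ k, Continuous fun p : PsiNoise n m L J Z × State n m L J => p.1.1 k :=
    fun k => by fun_prop
  have hH : ∀ k, Continuous fun p : PsiNoise n m L J Z × State n m L J =>
      rowsOf lab k p.1.2.1 := fun k => (continuous_rowsOf lab k).comp (by fun_prop)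
  have hW : ∀ k, Continuous fun p : PsiNoise n m L J Z × State n m L J => p.1.2.2.1 k :=
    fun k => by fun_prop
  have hΓ : ∀ k, Continuous fun p : PsiNoise n m L J Z × State n m L J => p.1.2.2.2 k :=
    fun k => by fun_prop
  refine ((continuous_finsetSum _ fun k _ => (continuous_const.matrix_mul
      ((hG k).fun_const_smul _)).matrix_mul (hAω k)).add
      (continuous_finsetSum _ fun k _ => ?_)).prodMk (continuous_assemble lab fun k => ?_)
  · exact ((continuous_const.matrix_mul hΘ).matrix_mul (hAθi k)).matrix_mul
      (continuous_blockUpper.comp ((((hH k).matrix_transpose.matrix_mul (hΩk k)).fun_const_smul _).add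
        ((((hW k).fun_const_smul σ).add
          (((hΓ k).matrix_mul (hAω k)).fun_const_smul z)).fun_const_smul _)))
  · exact ((hH k).matrix_mul (hAθ k)).add (((hΩk k).matrix_mul (hAωi k)).matrix_mul
      (continuous_blockStrictUpper.comp ((((((hG k).matrix_transpose.matrix_mul
        continuous_const).matrix_mul hΘ).add ((hW k).matrix_transpose.const_smul σ)).add
          (((hΓ k).matrix_transpose.matrix_mul (hAθ k)).fun_const_smul z)).fun_const_smul _)))

lemma measurable_phiPert (hσ : 0 < σ) (ξ : State n m L J) :
    Measurable fun p : PhiNoise n m L J Z =>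
      phiPert mix alg fac z lab p.1 p.2.1 p.2.2.1 p.2.2.2 ξ := by
  have h : Continuous fun p : PhiNoise n m L J Z => (p, ξ) := continuous_id.prodMk continuous_const
  exact ((continuous_phiPert alg mix fac z lab hσ).comp h).measurable

lemma measurable_psi (hσ : 0 < σ) (ξ : State n m L J) :
    Measurable fun p : PsiNoise n m L J Z =>
      psi mix alg fac z lab p.1 p.2.1 p.2.2.1 p.2.2.2 ξ := by
  have h : Continuous fun p : PsiNoise n m L J Z => (p, ξ) := continuous_id.prodMk continuous_const
  exact ((continuous_psi alg mix fac z lab hσ).comp h).measurable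

end Continuity

/-! ### Transfer of the fixed point results to states. -/

section Coordinates

variable (n m L J : ℕ)

/-- The index type of the scalar coordinates of a state. -/
abbrev StateIndex : Type := (Fin n × (Fin L × Fin J)) ⊕ (Fin m × (Fin L × Fin J))

/-- The scalar coordinates of a state. -/
def stateCoord : State n m L J ≃ₜ (StateIndex n m L J → ℝ) where
  toFun ξ := Sum.elim (fun p => ξ.1 p.1 p.2) (fun p => ξ.2 p.1 p.2)
  invFun v := (Matrix.of fun a c => v (Sum.inl (a, c)), Matrix.of fun i c => v (Sum.inr (i, c)))
  left_inv _ := rfl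
  right_inv v := by ext (p | p) <;> rfl
  continuous_toFun := by
    refine continuous_pi fun p => ?_
    rcases p with p | p
    · exact continuous_fst.matrix_elem p.1 p.2
    · exact continuous_snd.matrix_elem p.1 p.2
  continuous_invFun := by
    refine Continuous.prodMk (continuous_matrix fun a c => ?_) (continuous_matrix fun i c => ?_)
    · exact continuous_apply (Sum.inl (a, c))
    · exact continuous_apply (Sum.inr (i, c))

/-- The position of a coordinate in the order `p(0), q(0), p(1), q(1), …`. -/
def stateRank : StateIndex n m L J → ℕ :=
  Sum.elim (fun p => 2 * p.2.1 + 1) (fun p => 2 * p.2.1)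

variable {n m L J}

lemma IsStateCausal.isCausal {T : State n m L J → State n m L J} (hT : IsStateCausal T) :
    IsCausal (stateRank n m L J)
      fun v => stateCoord n m L J (T ((stateCoord n m L J).symm v)) := by
  intro v w p h
  rcases p with ⟨a, c⟩ | ⟨i, c⟩
  · have hQ : EqBelow c.1 ((stateCoord n m L J).symm v).1 ((stateCoord n m L J).symm w).1 :=
      fun b d hd => h (Sum.inl (b, d)) (by simp only [stateRank, Sum.elim_inl]; omega)
    have hP : EqBelow (c.1 + 1) ((stateCoord n m L J).symm v).2
        ((stateCoord n m L J).symm w).2 :=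
      fun b d hd => h (Sum.inr (b, d)) (by simp only [stateRank, Sum.elim_inl, Sum.elim_inr]; omega)
    exact (hT _ _ _ hQ (hP.mono (Nat.le_succ _))).2 hP a c (Nat.lt_succ_self _)
  · have hQ : EqBelow c.1 ((stateCoord n m L J).symm v).1 ((stateCoord n m L J).symm w).1 :=
      fun b d hd => h (Sum.inl (b, d)) (by simp only [stateRank, Sum.elim_inl, Sum.elim_inr]; omega)
    have hP : EqBelow c.1 ((stateCoord n m L J).symm v).2 ((stateCoord n m L J).symm w).2 :=
      fun b d hd => h (Sum.inr (b, d)) (by simp only [stateRank, Sum.elim_inr]; omega)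
    exact (hT _ _ _ hQ hP).1 i c (Nat.lt_succ_self _)

/-- The fixed point of a causal map of states. -/
def stateFix (T : State n m L J → State n m L J) : State n m L J :=
  (stateCoord n m L J).symm (causalFix (stateRank n m L J)
    fun v => stateCoord n m L J (T ((stateCoord n m L J).symm v)))

lemma IsStateCausal.map_stateFix {T : State n m L J → State n m L J} (hT : IsStateCausal T) :
    T (stateFix T) = stateFix T := by
  have h := hT.isCausal.map_causalFix
  exact (stateCoord n m L J).injective (by rw [stateFix, h, Homeomorph.apply_symm_apply])

lemma IsStateCausal.eq_stateFix {T : State n m L J → State n m L J} (hT : IsStateCausal T)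
    {ξ : State n m L J} (h : T ξ = ξ) : ξ = stateFix T := by
  rw [stateFix, ← hT.isCausal.eq_causalFix (v := stateCoord n m L J ξ)
    (by simp only [Homeomorph.symm_apply_apply, h]), Homeomorph.symm_apply_apply]

variable {α β : Type*} [MeasurableSpace α] [MeasurableSpace β]
  {T : α → State n m L J → State n m L J} {T' : β → State n m L J → State n m L J}

lemma measurable_stateFix (hc : ∀ a, Continuous (T a)) (hm : ∀ ξ, Measurable fun a => T a ξ) :
    Measurable fun a => stateFix (T a) :=
  (stateCoord n m L J).symm.continuous.measurable.comp (measurable_causalFix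
    (fun a => (stateCoord n m L J).continuous.comp ((hc a).comp
      (stateCoord n m L J).symm.continuous))
    (fun _ => (stateCoord n m L J).continuous.measurable.comp (hm _)))

/-- The law of the fixed point of a continuous causal random map of states is determined by the
laws of the values of the map at the deterministic states. -/
theorem map_stateFix_eq {μ : Measure α} {ν : Measure β} [IsFiniteMeasure μ] [IsFiniteMeasure ν]
    (hT : ∀ a, IsStateCausal (T a)) (hT' : ∀ b, IsStateCausal (T' b))
    (hc : ∀ a, Continuous (T a)) (hm : ∀ ξ, Measurable fun a => T a ξ)
    (hc' : ∀ b, Continuous (T' b)) (hm' : ∀ ξ, Measurable fun b => T' b ξ)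
    (hlaw : ∀ ξ, μ.map (fun a => T a ξ) = ν.map (fun b => T' b ξ)) :
    μ.map (fun a => stateFix (T a)) = ν.map (fun b => stateFix (T' b)) := by
  set e := stateCoord n m L J
  have hC := fun a => e.continuous.comp ((hc a).comp e.symm.continuous)
  have hC' := fun b => e.continuous.comp ((hc' b).comp e.symm.continuous)
  have hM := fun v => e.continuous.measurable.comp (hm (e.symm v))
  have hM' := fun v => e.continuous.measurable.comp (hm' (e.symm v))
  have key := map_causalFix_eq (μ := μ) (ν := ν) (F := fun a v => e (T a (e.symm v)))
    (F' := fun b v => e (T' b (e.symm v))) (fun a => (hT a).isCausal)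
    (fun b => (hT' b).isCausal) hC hM hC' hM' fun v => by
      have := congrArg (Measure.map e) (hlaw (e.symm v))
      rwa [Measure.map_map e.continuous.measurable (hm _),
        Measure.map_map e.continuous.measurable (hm' _)] at this
  have := congrArg (Measure.map e.symm) key
  have hfix := measurable_causalFix (r := stateRank n m L J)
    (F := fun a v => e (T a (e.symm v))) hC hM
  have hfix' := measurable_causalFix (r := stateRank n m L J)
    (F := fun b v => e (T' b (e.symm v))) hC' hM'
  rwa [Measure.map_map e.symm.continuous.measurable hfix,
    Measure.map_map e.symm.continuous.measurable hfix'] at this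

end Coordinates

/-! ### The Frobenius inner product. -/

section Frobenius

open Matrix

variable {ι κ : Type*} [Fintype ι] [Fintype κ]

/-- The Frobenius inner product. -/
def frob (M N : Matrix ι κ ℝ) : ℝ := (Mᵀ * N).trace

lemma frob_eq_sum (M N : Matrix ι κ ℝ) : frob M N = ∑ i, ∑ j, M i j * N i j := by
  simp only [frob, trace, diag_apply, mul_apply, transpose_apply]
  exact Finset.sum_comm

lemma frob_comm (M N : Matrix ι κ ℝ) : frob M N = frob N M := by
  simp only [frob_eq_sum, mul_comm]

lemma frob_add_left (M M' N : Matrix ι κ ℝ) : frob (M + M') N = frob M N + frob M' N := by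
  simp [frob, Matrix.add_mul]

lemma frob_add_right (M N N' : Matrix ι κ ℝ) : frob M (N + N') = frob M N + frob M N' := by
  simp [frob, Matrix.mul_add]

lemma frob_sub_left (M M' N : Matrix ι κ ℝ) : frob (M - M') N = frob M N - frob M' N := by
  simp [frob, Matrix.sub_mul]

lemma frob_sub_right (M N N' : Matrix ι κ ℝ) : frob M (N - N') = frob M N - frob M N' := by
  simp [frob, Matrix.mul_sub]

lemma frob_smul_left (a : ℝ) (M N : Matrix ι κ ℝ) : frob (a • M) N = a * frob M N := by
  simp [frob]

lemma frob_smul_right (a : ℝ) (M N : Matrix ι κ ℝ) : frob M (a • N) = a * frob M N := by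
  simp [frob]

lemma frob_sum_right {K : Type*} (s : Finset K) (M : Matrix ι κ ℝ) (N : K → Matrix ι κ ℝ) :
    frob M (∑ k ∈ s, N k) = ∑ k ∈ s, frob M (N k) := by
  simp [frob, Matrix.mul_sum, trace_sum]

lemma frob_transpose (M N : Matrix ι κ ℝ) : frob Mᵀ Nᵀ = frob M N := by
  simp only [frob_eq_sum, transpose_apply]
  exact Finset.sum_comm

variable {l : Type*} [Fintype l]

lemma frob_mul_left (A : Matrix ι l ℝ) (M : Matrix l κ ℝ) (N : Matrix ι κ ℝ) :
    frob (A * M) N = frob M (Aᵀ * N) := by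
  simp [frob, Matrix.mul_assoc]

lemma frob_mul_right (A : Matrix l κ ℝ) (M : Matrix ι l ℝ) (N : Matrix ι κ ℝ) :
    frob (M * A) N = frob M (N * Aᵀ) := by
  rw [frob, frob, transpose_mul, Matrix.mul_assoc, trace_mul_comm, Matrix.mul_assoc]

lemma frob_self_add (M N : Matrix ι κ ℝ) :
    frob (M + N) (M + N) = frob M M + 2 * frob M N + frob N N := by
  rw [frob_add_left, frob_add_right, frob_add_right, frob_comm N M]; ring

lemma frob_self_smul (a : ℝ) (M : Matrix ι κ ℝ) : frob (a • M) (a • M) = a ^ 2 * frob M M := by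
  rw [frob_smul_left, frob_smul_right]; ring

end Frobenius

/-! ### The variance identity for one mixture component. -/

section Variance

open Matrix

variable {L J : ℕ}

lemma frob_eq_zero_of_lower_of_upper {M N : BlockSq L J} (hM : ∀ a b, a.1 ≤ b.1 → M a b = 0)
    (hN : N.BlockTriangular Prod.fst) : frob M N = 0 := by
  rw [frob_eq_sum]
  refine Finset.sum_eq_zero fun a _ => Finset.sum_eq_zero fun b _ => ?_
  rcases le_or_gt a.1 b.1 with h | h
  · rw [hM a b h, zero_mul]
  · rw [hN h, mul_zero]

lemma frob_blockUpper_blockStrictUpper_transpose (α β : BlockSq L J) :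
    frob (blockUpper α) (blockStrictUpper β)ᵀ = 0 := by
  rw [frob_comm]
  exact frob_eq_zero_of_lower_of_upper
    (fun a b h => if_neg (not_lt.2 h)) (blockTriangular_blockUpper α)

/-- Strictly lower times lower is strictly lower, and upper times upper is upper, so the supports
are disjoint. The diagonal blocks must be kept in exactly one of the two truncations for this. -/
lemma frob_sub_blockUpper_mul_sub_blockStrictUpper (α β : BlockSq L J) {A B : BlockSq L J}
    (hA : A.BlockTriangular Prod.fst) (hB : B.BlockTriangular Prod.fst) :
    frob ((α - blockUpper α) * Bᵀ) (A * (β - blockStrictUpper β)ᵀ) = 0 := by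
  refine frob_eq_zero_of_lower_of_upper (fun a b h => ?_) (hA.mul fun a b h => ?_)
  · rw [mul_apply]
    refine Finset.sum_eq_zero fun d _ => ?_
    rcases le_or_gt a.1 d.1 with hd | hd
    · simp [blockUpper, hd]
    · rw [transpose_apply, hB (hd.trans_le h), mul_zero]
  · simp [blockStrictUpper, show b.1 < a.1 from h]

variable {ι ν : Type*} [Fintype ι] [Fintype ν]

/-- The variances of a linear functional (with coefficients `C`, `D`) of the values of the two
processes at a deterministic state, for one component of the mixture. -/
lemma variance_identity (s σ z : ℝ) {S R : Matrix ι ι ℝ} (hS : Sᵀ = S) (hR : S * S = R)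
    {Θ C : Matrix ι (Fin L × Fin J) ℝ} {Ω D : Matrix ν (Fin L × Fin J) ℝ} {A B α β : BlockSq L J}
    (hA : A.BlockTriangular Prod.fst) (hB : B.BlockTriangular Prod.fst)
    (hAA : Aᵀ * A = Θᵀ * R * Θ + σ ^ 2 • (1 : BlockSq L J))
    (hBB : Bᵀ * B = s ^ 2 • (Ωᵀ * Ω) + σ ^ 2 • (1 : BlockSq L J))
    (hα : Aᵀ * α = Θᵀ * R * C) (hβ : Bᵀ * β = Ωᵀ * D) :
    frob (s ^ 2 • (C * Ωᵀ) + Θ * Dᵀ) (R * (s ^ 2 • (C * Ωᵀ) + Θ * Dᵀ))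
        + (σ * s) ^ 2 * frob (S * C) (S * C) + σ ^ 2 * frob D D
        + (1 + z ^ 2) * s ^ 2 * frob (blockUpper α * Bᵀ + A * (blockStrictUpper β)ᵀ)
            (blockUpper α * Bᵀ + A * (blockStrictUpper β)ᵀ) =
      s ^ 2 * frob (S * C * Bᵀ + S * Θ * (blockStrictUpper β)ᵀ)
          (S * C * Bᵀ + S * Θ * (blockStrictUpper β)ᵀ)
        + frob (D * Aᵀ + s ^ 2 • (Ω * (blockUpper α)ᵀ)) (D * Aᵀ + s ^ 2 • (Ω * (blockUpper α)ᵀ))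
        + (σ * s) ^ 2 * frob (blockUpper α + (blockStrictUpper β)ᵀ)
            (blockUpper α + (blockStrictUpper β)ᵀ)
        + (z * s) ^ 2 * frob (blockUpper α * Bᵀ + A * (blockStrictUpper β)ᵀ)
            (blockUpper α * Bᵀ + A * (blockStrictUpper β)ᵀ) := by
  -- Triangularity is used in these two orthogonality relations only: `z1` removes the cross term of
  -- `W`, and `z2` is the residual of the whole comparison. From here on the truncations are
  -- arbitrary matrices `α'`, `β'`.
  have z1 := frob_blockUpper_blockStrictUpper_transpose α β
  have z2 := frob_sub_blockUpper_mul_sub_blockStrictUpper α β hA hB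
  generalize blockUpper α = α' at *
  generalize blockStrictUpper β = β' at *
  have hRT : Rᵀ = R := by rw [← hR, transpose_mul, hS]
  have hSM : ∀ {κ : Type} [Fintype κ] (M N : Matrix ι κ ℝ), frob (S * M) (S * N) = frob M (R * N) :=
    fun M N => by rw [frob_mul_left, hS, ← Matrix.mul_assoc, hR]
  have hα' : αᵀ * A = Cᵀ * R * Θ := by
    have := congrArg transpose hα
    simpa [hRT, Matrix.mul_assoc] using this
  -- The identities `f1` to `f4` expand the squared norms through `AᵀA` and `BᵀB`; the `σ ^ 2` parts
  -- account for the perturbations by `U`, `V` and `W`.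
  have f1 : frob (S * C * Bᵀ) (S * C * Bᵀ) =
      s ^ 2 * frob (C * Ωᵀ) (R * (C * Ωᵀ)) + σ ^ 2 * frob C (R * C) := by
    rw [Matrix.mul_assoc, hSM, frob_mul_right, transpose_transpose]
    rw [show R * (C * Bᵀ) * B = R * C * (Bᵀ * B) by simp only [Matrix.mul_assoc], hBB,
      Matrix.mul_add, frob_add_right, Matrix.mul_smul, Matrix.mul_smul, frob_smul_right,
      frob_smul_right, Matrix.mul_one, frob_mul_right, transpose_transpose]
    simp only [Matrix.mul_assoc]
  have f2 : frob (D * Aᵀ) (D * Aᵀ) = frob (Θ * Dᵀ) (R * (Θ * Dᵀ)) + σ ^ 2 * frob D D := by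
    rw [frob_mul_right, transpose_transpose, Matrix.mul_assoc, hAA, Matrix.mul_add,
      frob_add_right, Matrix.mul_smul, frob_smul_right, Matrix.mul_one, ← frob_transpose D,
      frob_mul_left]
    simp only [Matrix.mul_assoc, transpose_mul, transpose_transpose, hRT]
  have f3 : frob (α' * Bᵀ) (α' * Bᵀ) =
      s ^ 2 * frob (Ω * α'ᵀ) (Ω * α'ᵀ) + σ ^ 2 * frob α' α' := by
    rw [frob_mul_right, transpose_transpose, Matrix.mul_assoc, hBB, Matrix.mul_add,
      frob_add_right, Matrix.mul_smul, Matrix.mul_smul, frob_smul_right, frob_smul_right,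
      Matrix.mul_one, ← frob_transpose α', frob_mul_left]
    simp only [Matrix.mul_assoc, transpose_mul, transpose_transpose]
  have f4 : frob (A * β'ᵀ) (A * β'ᵀ) =
      frob (S * Θ * β'ᵀ) (S * Θ * β'ᵀ) + σ ^ 2 * frob β'ᵀ β'ᵀ := by
    rw [frob_mul_left, ← Matrix.mul_assoc, hAA, Matrix.add_mul, frob_add_right, Matrix.smul_mul,
      frob_smul_right, Matrix.one_mul, Matrix.mul_assoc S, hSM, frob_mul_left]
    simp only [Matrix.mul_assoc]
  -- The cross terms become products of `α` or `α'` with `β` or `β'`, so that they can be collected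
  -- into the bilinear expression of `z2`.
  have g1 : frob (C * Ωᵀ) (R * (Θ * Dᵀ)) = frob (α * Bᵀ) (A * βᵀ) := by
    have h1 : Dᵀ * Ω = βᵀ * B := by
      have := congrArg transpose hβ
      simpa using this.symm
    rw [frob_mul_right, frob_mul_right, transpose_transpose, transpose_transpose]
    simp only [Matrix.mul_assoc]
    rw [h1, frob, frob]
    simp only [← Matrix.mul_assoc]
    rw [hα']
  have g2 : frob (S * C * Bᵀ) (S * Θ * β'ᵀ) = frob (α * Bᵀ) (A * β'ᵀ) := by
    rw [Matrix.mul_assoc S, Matrix.mul_assoc S, hSM, frob_mul_right, frob_mul_right, frob, frob]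
    simp only [← Matrix.mul_assoc]
    rw [hα']
  have g3 : frob (D * Aᵀ) (Ω * α'ᵀ) = frob (α' * Bᵀ) (A * βᵀ) := by
    rw [frob_comm, frob_mul_left, ← Matrix.mul_assoc, ← hβ, ← frob_transpose, frob_mul_right]
    simp only [Matrix.mul_assoc, transpose_mul, transpose_transpose]
  have hz2 : frob (α * Bᵀ) (A * βᵀ) - frob (α * Bᵀ) (A * β'ᵀ) - frob (α' * Bᵀ) (A * βᵀ)
      + frob (α' * Bᵀ) (A * β'ᵀ) = 0 := by
    rw [← z2, transpose_sub, Matrix.mul_sub, Matrix.sub_mul, frob_sub_right, frob_sub_left,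
      frob_sub_left]
    ring
  have g1' : frob (Θ * Dᵀ) (R * (C * Ωᵀ)) = frob (α * Bᵀ) (A * βᵀ) := by
    rw [← g1, frob_comm, frob_mul_left, hRT]
  have hB1 : frob (s ^ 2 • (C * Ωᵀ) + Θ * Dᵀ) (R * (s ^ 2 • (C * Ωᵀ) + Θ * Dᵀ)) =
      s ^ 4 * frob (C * Ωᵀ) (R * (C * Ωᵀ)) + 2 * s ^ 2 * frob (α * Bᵀ) (A * βᵀ)
        + frob (Θ * Dᵀ) (R * (Θ * Dᵀ)) := by
    simp only [Matrix.mul_add, Matrix.mul_smul, frob_add_left, frob_add_right, frob_smul_left,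
      frob_smul_right, g1, g1']
    ring
  rw [hB1, hSM C C]
  simp only [frob_self_add, frob_smul_left, frob_smul_right, z1, f1, f2, f3, f4, g2, g3]
  -- All squares cancel; the four remaining cross terms are the expansion of `frob ((α - α') * Bᵀ)
  -- (A * (β - β')ᵀ)`.
  linear_combination 2 * s ^ 2 * hz2

end Variance

/-! ### Gaussian characteristic functions of linear functionals. -/

section GaussChar

open Complex (I)

/-- The characteristic function of `ℓ` under `μ` at `1` is that of a Gaussian variable with mean
`a` and variance `v`. -/
def HasGaussChar {E : Type*} [MeasurableSpace E] (μ : Measure E) (ℓ : E → ℝ) (a v : ℝ) : Prop :=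
  ∫ x, Complex.exp (ℓ x * I) ∂μ = Complex.exp (a * I - v / 2)

variable {E E' : Type*} [MeasurableSpace E] [MeasurableSpace E'] {μ : Measure E} {μ' : Measure E'}
  {ℓ : E → ℝ} {ℓ' : E' → ℝ} {a a' v v' : ℝ}

lemma HasGaussChar.prod [SFinite μ] [SFinite μ'] (h : HasGaussChar μ ℓ a v)
    (h' : HasGaussChar μ' ℓ' a' v') :
    HasGaussChar (μ.prod μ') (fun p => ℓ p.1 + ℓ' p.2) (a + a') (v + v') := by
  unfold HasGaussChar at *
  have : ∀ p : E × E', Complex.exp (((ℓ p.1 + ℓ' p.2 : ℝ) : ℂ) * I) =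
      Complex.exp (ℓ p.1 * I) * Complex.exp (ℓ' p.2 * I) := fun p => by
    rw [← Complex.exp_add]; push_cast; ring_nf
  simp_rw [this]
  rw [integral_prod_mul (fun x => Complex.exp (ℓ x * I)) (fun x => Complex.exp (ℓ' x * I)), h, h',
    ← Complex.exp_add]
  push_cast; ring_nf

/-- Characteristic functions of independent sums multiply, so variances add. The mean is fixed at
zero because all the families to which this is applied are centred. -/
lemma HasGaussChar.pi {K : Type*} [Fintype K] {E : K → Type*} [∀ k, MeasurableSpace (E k)]
    {μ : ∀ k, Measure (E k)} [∀ k, SigmaFinite (μ k)] {ℓ : ∀ k, E k → ℝ} {v : K → ℝ}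
    (h : ∀ k, HasGaussChar (μ k) (ℓ k) 0 (v k)) :
    HasGaussChar (Measure.pi μ) (fun x => ∑ k, ℓ k (x k)) 0 (∑ k, v k) := by
  unfold HasGaussChar at *
  have : ∀ x : ∀ k, E k, Complex.exp (((∑ k, ℓ k (x k) : ℝ) : ℂ) * I) =
      ∏ k, Complex.exp (ℓ k (x k) * I) := fun x => by
    rw [← Complex.exp_sum]; push_cast; rw [Finset.sum_mul]
  simp_rw [this]
  rw [integral_fintype_prod_eq_prod (fun k x => Complex.exp (ℓ k x * I))]
  simp_rw [h]
  rw [← Complex.exp_sum]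
  push_cast
  rw [Finset.sum_sub_distrib, Finset.sum_div]
  simp

lemma HasGaussChar.add_const (h : HasGaussChar μ ℓ a v) (c : ℝ) :
    HasGaussChar μ (fun x => ℓ x + c) (a + c) v := by
  unfold HasGaussChar at *
  have : ∀ x, Complex.exp (((ℓ x + c : ℝ) : ℂ) * I) =
      Complex.exp (ℓ x * I) * Complex.exp (c * I) := fun x => by
    rw [← Complex.exp_add]; push_cast; ring_nf
  simp_rw [this]
  rw [integral_mul_const, h, ← Complex.exp_add]
  push_cast; ring_nf

lemma hasGaussChar_gaussianReal (c : ℝ) :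
    HasGaussChar (gaussianReal 0 1) (fun x => c * x) 0 (c ^ 2) := by
  have := charFun_gaussianReal (μ := 0) (v := 1) c
  rw [charFun_apply_real] at this
  unfold HasGaussChar
  push_cast
  rw [this]
  simp

instance {ι κ : Type*} [Fintype ι] [Fintype κ] :
    IsProbabilityMeasure (stdGaussianMatrix ι κ) :=
  inferInstanceAs (IsProbabilityMeasure
    (Measure.pi fun _ : ι => Measure.pi fun _ : κ => gaussianReal 0 1))

lemma hasGaussChar_stdGaussianMatrix {ι κ : Type*} [Fintype ι] [Fintype κ] (C : Matrix ι κ ℝ) :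
    HasGaussChar (stdGaussianMatrix ι κ) (fun M => frob C M) 0 (frob C C) := by
  have := HasGaussChar.pi (μ := fun _ : ι => Measure.pi fun _ : κ => gaussianReal 0 1)
    fun i => HasGaussChar.pi fun j => hasGaussChar_gaussianReal (C i j)
  simp only [frob_eq_sum, ← pow_two]
  exact this

lemma hasGaussChar_multivariateGaussian {n : ℕ} (m : EuclideanSpace ℝ (Fin n))
    {R : Matrix (Fin n) (Fin n) ℝ} (hR : R.PosSemidef) (t : Fin n → ℝ) :
    HasGaussChar (multivariateGaussian m R) (fun x => ∑ a, t a * (x a - m a)) 0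
      (t ⬝ᵥ R.mulVec t) := by
  have h : HasGaussChar (multivariateGaussian m R) (fun x => ∑ a, t a * x a)
      (∑ a, t a * m a) (t ⬝ᵥ R.mulVec t) := by
    have := charFun_multivariateGaussian (μ := m) hR (WithLp.toLp 2 t)
    rw [charFun_apply] at this
    unfold HasGaussChar
    simpa [PiLp.inner_apply, mul_comm] using this
  have h2 := h.add_const (-∑ a, t a * m a)
  simp only [← sub_eq_add_neg, sub_self] at h2
  simpa only [mul_sub, Finset.sum_sub_distrib] using h2

end GaussChar

/-! ### Laws on the state space are determined by characteristic functions. -/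

section Ext

variable {n m L J : ℕ}

lemma state_measure_ext {μ ν : Measure (State n m L J)} [IsFiniteMeasure μ] [IsFiniteMeasure ν]
    (h : ∀ (C : BlockRow n L J) (D : BlockRow m L J),
      ∫ ξ, Complex.exp ((frob C ξ.1 + frob D ξ.2 : ℝ) * Complex.I) ∂μ =
        ∫ ξ, Complex.exp ((frob C ξ.1 + frob D ξ.2 : ℝ) * Complex.I) ∂ν) : μ = ν := by
  set e := stateCoord n m L J
  have he := e.continuous.measurable
  have key : μ.map e = ν.map e := by
    refine Measure.ext_of_charFunDual (funext fun ℓ => ?_)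
    -- Every linear functional of the coordinates is a pair of Frobenius pairings, with its values
    -- on the standard basis as the coefficients.
    have hℓ : ∀ ξ, ℓ (e ξ) = frob (Matrix.of fun a c => ℓ (Pi.single (Sum.inl (a, c)) 1)) ξ.1
        + frob (Matrix.of fun i c => ℓ (Pi.single (Sum.inr (i, c)) 1)) ξ.2 := fun ξ => by
      have h1 := LinearMap.pi_apply_eq_sum_univ ℓ.toLinearMap (e ξ)
      simp only [ContinuousLinearMap.coe_coe] at h1
      rw [h1, Fintype.sum_sum_type, Fintype.sum_prod_type, Fintype.sum_prod_type, frob_eq_sum,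
        frob_eq_sum]
      congr 1 <;> refine Finset.sum_congr rfl fun a _ => Finset.sum_congr rfl fun c _ => ?_ <;>
      · rw [Matrix.of_apply, smul_eq_mul, mul_comm]
        congr 2
        funext p
        simp [Pi.single_apply, eq_comm]
    rw [charFunDual_apply, charFunDual_apply, integral_map he.aemeasurable,
      integral_map he.aemeasurable]
    · simp_rw [hℓ]
      exact h _ _
    · exact (by fun_prop : Continuous fun v => Complex.exp (ℓ v * Complex.I)).aestronglyMeasurable
    · exact (by fun_prop : Continuous fun v => Complex.exp (ℓ v * Complex.I)).aestronglyMeasurable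
  have h2 := congrArg (Measure.map e.symm) key
  rw [Measure.map_map e.symm.continuous.measurable he,
    Measure.map_map e.symm.continuous.measurable he] at h2
  simpa using h2

end Ext

/-! ### Equality of the laws at a deterministic state. -/

section FixedState

open Matrix

variable {n m L J : ℕ} {Z Y : Type*}

/-- Truncation is an orthogonal projection, hence self-adjoint; this moves the triangular parts from
the noise to the coefficients. -/
lemma frob_blockUpper_right (M N : BlockSq L J) :
    frob M (blockUpper N) = frob (blockUpper M) N := by
  simp only [frob_eq_sum, blockUpper, of_apply, mul_ite, ite_mul, mul_zero, zero_mul]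

lemma frob_blockStrictUpper_right (M N : BlockSq L J) :
    frob M (blockStrictUpper N) = frob (blockStrictUpper M) N := by
  simp only [frob_eq_sum, blockStrictUpper, of_apply, mul_ite, ite_mul, mul_zero, zero_mul]

open scoped Classical in
lemma sum_labels [Fintype Z] (lab : Fin m → Z) (f : Fin m → ℝ) :
    ∑ i, f i = ∑ k, ∑ i : {i : Fin m // lab i = k}, f i.1 :=
  (Fintype.sum_fiberwise lab f).symm

open scoped Classical in
lemma frob_assemble [Fintype Z] (lab : Fin m → Z) {κ : Type*} [Fintype κ] (D : Matrix (Fin m) κ ℝ)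
    (E : (k : Z) → Matrix {i : Fin m // lab i = k} κ ℝ) :
    frob D (assemble lab E) = ∑ k, frob (rowsOf lab k D) (E k) := by
  simp only [frob_eq_sum]
  rw [sum_labels lab]
  refine Finset.sum_congr rfl fun k _ => Finset.sum_congr rfl fun i _ => ?_
  obtain ⟨i, rfl⟩ := i
  rfl

lemma rowsOf_assemble (lab : Fin m → Z) {κ : Type*}
    (E : (k : Z) → Matrix {i : Fin m // lab i = k} κ ℝ) (k : Z) :
    rowsOf lab k (assemble lab E) = E k := by
  ext ⟨i, rfl⟩ c
  rfl

open scoped Classical in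
lemma frob_eq_sum_rowsOf [Fintype Z] (lab : Fin m → Z) {κ : Type*} [Fintype κ] (D E : Matrix (Fin m) κ ℝ) :
    frob D E = ∑ k, frob (rowsOf lab k D) (rowsOf lab k E) := by
  rw [← frob_assemble]
  rfl

lemma Mixture.sqrtCov_mul_self (mix : Mixture n Z Y) (k : Z) :
    mix.sqrtCov k * mix.sqrtCov k = mix.cov k := by
  open scoped MatrixOrder in
  exact CFC.sqrt_mul_sqrt_self _ (Matrix.nonneg_iff_posSemidef.2 (mix.posSemidef_cov k))

lemma Mixture.transpose_sqrtCov (mix : Mixture n Z Y) (k : Z) :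
    (mix.sqrtCov k)ᵀ = mix.sqrtCov k := by
  open scoped MatrixOrder in
  have h : (mix.sqrtCov k).PosSemidef := Matrix.nonneg_iff_posSemidef.1 (CFC.sqrt_nonneg _)
  simpa using h.isHermitian.eq

variable (mix : Mixture n Z Y) {σ : ℝ} (fac : Factors m L J mix σ)

/-- The adjoint of `M ↦ R(k) Θ A_θ(k)⁻¹ M_u` at `C`. -/
def adjTheta (k : Z) (Θ C : BlockRow n L J) : BlockSq L J :=
  blockUpper ((mix.cov k * Θ * (fac.Aθ k Θ)⁻¹)ᵀ * C)

open scoped Classical in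
/-- The adjoint of `M ↦ Ω_k A_ω(k)⁻¹ M_U` at `D`. -/
def adjOmega (lab : Fin m → Z) (k : Z) (Ω D : BlockRow m L J) : BlockSq L J :=
  blockStrictUpper ((rowsOf lab k Ω * (fac.Aω lab k Ω)⁻¹)ᵀ * rowsOf lab k D)

lemma frob_mul_blockUpper (k : Z) (Θ C : BlockRow n L J) (M : BlockSq L J) :
    frob C (mix.cov k * Θ * (fac.Aθ k Θ)⁻¹ * blockUpper M) = frob (adjTheta mix fac k Θ C) M := by
  rw [adjTheta, ← frob_blockUpper_right, frob_mul_left, transpose_transpose]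

open scoped Classical in
lemma frob_mul_blockStrictUpper (lab : Fin m → Z) (k : Z) (Ω D : BlockRow m L J)
    (M : BlockSq L J) :
    frob (rowsOf lab k D) (rowsOf lab k Ω * (fac.Aω lab k Ω)⁻¹ * blockStrictUpper M) =
      frob (adjOmega mix fac lab k Ω D) M := by
  rw [adjOmega, ← frob_blockStrictUpper_right, frob_mul_left, transpose_transpose]

/-- The coefficient of `Γ_k`, up to a scalar. -/
def coefGamma (lab : Fin m → Z) (k : Z) (Θ C : BlockRow n L J) (Ω D : BlockRow m L J) :
    BlockSq L J :=
  adjTheta mix fac k Θ C * (fac.Aω lab k Ω)ᵀ + fac.Aθ k Θ * (adjOmega mix fac lab k Ω D)ᵀ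

lemma frob_coefGamma (lab : Fin m → Z) (k : Z) (Θ C : BlockRow n L J) (Ω D : BlockRow m L J)
    (M : BlockSq L J) :
    frob (coefGamma mix fac lab k Θ C Ω D) M =
      frob (adjTheta mix fac k Θ C) (M * fac.Aω lab k Ω)
        + frob (adjOmega mix fac lab k Ω D) (Mᵀ * fac.Aθ k Θ) := by
  rw [coefGamma, frob_add_left, frob_mul_right, transpose_transpose, frob_mul_left]
  congr 1
  rw [← frob_transpose]
  simp

variable (alg : Algorithm n m L J Y) (z : ℝ) (lab : Fin m → Z)

lemma frob_dataMatrix (B : Matrix (Fin n) (Fin m) ℝ) (x : Fin m → EuclideanSpace ℝ (Fin n)) :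
    frob B (dataMatrix x - mix.meanMatrix lab) =
      ∑ i, ∑ a, B a i * (x i a - mix.mean (lab i) a) := by
  rw [frob_eq_sum, Finset.sum_comm]
  rfl

variable [Fintype Z]

/-- The law of the random inputs of the perturbed original process, given the latent labels. -/
def phiLaw (L J : ℕ) : Measure (PhiNoise n m L J Z) :=
  (Measure.pi fun i => multivariateGaussian (mix.mean (lab i)) (mix.cov (lab i))).prod
    ((Measure.pi fun _ : Z => stdGaussianMatrix (Fin n) (Fin L × Fin J)).prod
        ((stdGaussianMatrix (Fin m) (Fin L × Fin J)).prod
          (Measure.pi fun _ : Z => stdGaussianMatrix (Fin L × Fin J) (Fin L × Fin J))))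

variable (n m L J Z) in
/-- The law of the random inputs of the alternative process. -/
def psiLaw : Measure (PsiNoise n m L J Z) :=
  (Measure.pi fun _ : Z => stdGaussianMatrix (Fin n) (Fin L × Fin J)).prod
    ((stdGaussianMatrix (Fin m) (Fin L × Fin J)).prod
      ((Measure.pi fun _ : Z => stdGaussianMatrix (Fin L × Fin J) (Fin L × Fin J)).prod
        (Measure.pi fun _ : Z => stdGaussianMatrix (Fin L × Fin J) (Fin L × Fin J))))

instance : IsProbabilityMeasure (phiLaw mix lab L J) := by
  unfold phiLaw; infer_instance

instance : IsProbabilityMeasure (psiLaw n m L J Z) := by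
  unfold psiLaw; infer_instance

/-- Writing the functional as a sum of pairings, one for each independent noise, exposes the
coefficients whose squared norms make up the variance. The data contribute to both components
through the same matrix, hence the single coefficient `(1 / m) • (C * Ωᵀ) + Θ * Dᵀ`. -/
lemma frob_phiPert (ξ : State n m L J) (C : BlockRow n L J) (D : BlockRow m L J)
    (p : PhiNoise n m L J Z) :
    let Θ := alg.Theta (fun i => mix.cls (lab i)) ξ
    let Ω := alg.Omega (fun i => mix.cls (lab i)) ξ
    let T := phiPert mix alg fac z lab p.1 p.2.1 p.2.2.1 p.2.2.2 ξ
    frob C T.1 + frob D T.2 =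
      (∑ i, ∑ a, ((1 / (m : ℝ)) • (C * Ωᵀ) + Θ * Dᵀ) a i * (p.1 i a - mix.mean (lab i) a)) +
        (∑ k, frob ((σ * (1 / √(m : ℝ))) • (mix.sqrtCov k * C)) (p.2.1 k) +
          (frob (σ • D) p.2.2.1 +
            ∑ k, frob (√((1 + z ^ 2) / (m : ℝ)) • coefGamma mix fac lab k Θ C Ω D)
              (p.2.2.2 k))) := by
  intro Θ Ω T
  classical
  set X := dataMatrix p.1 - mix.meanMatrix lab with hX
  have h1 : T.1 = (1 / (m : ℝ)) • (X * Ω) + σ • ((1 / √(m : ℝ)) • ∑ k, mix.sqrtCov k * p.2.1 k)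
      + √((1 + z ^ 2) / (m : ℝ)) • ∑ k, mix.cov k * Θ * (fac.Aθ k Θ)⁻¹ *
        blockUpper (p.2.2.2 k * fac.Aω lab k Ω) := rfl
  have h2 : T.2 = Xᵀ * Θ + σ • p.2.2.1 + √((1 + z ^ 2) / (m : ℝ)) • assemble lab fun k =>
      rowsOf lab k Ω * (fac.Aω lab k Ω)⁻¹ * blockStrictUpper ((p.2.2.2 k)ᵀ * fac.Aθ k Θ) := rfl
  rw [h1, h2, ← frob_dataMatrix mix lab, ← hX]
  simp only [frob_add_right, frob_add_left, frob_smul_right, frob_smul_left, frob_sum_right,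
    frob_assemble, frob_mul_blockUpper, frob_mul_blockStrictUpper, frob_coefGamma]
  have e1 : frob C (X * Ω) = frob (C * Ωᵀ) X := by
    rw [frob_mul_right, transpose_transpose]
  have e2 : frob D (Xᵀ * Θ) = frob (Θ * Dᵀ) X := by
    rw [frob_mul_left, ← frob_transpose D]
    simp
  have e3 : ∀ k, frob C (mix.sqrtCov k * p.2.1 k) = frob (mix.sqrtCov k * C) (p.2.1 k) := fun k => by
    rw [frob_mul_left, mix.transpose_sqrtCov]
  simp only [e1, e2, e3, mul_add, Finset.sum_add_distrib, Finset.mul_sum]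
  simp only [mul_assoc]
  ring

open scoped Classical in
/-- The coefficient of `H`. -/
def coefH (ξ : State n m L J) (C : BlockRow n L J) (D : BlockRow m L J) : BlockRow m L J :=
  let Θ := alg.Theta (fun i => mix.cls (lab i)) ξ
  let Ω := alg.Omega (fun i => mix.cls (lab i)) ξ
  assemble lab fun k => rowsOf lab k D * (fac.Aθ k Θ)ᵀ
    + (1 / (m : ℝ)) • (rowsOf lab k Ω * (adjTheta mix fac k Θ C)ᵀ)

/-- Each of `G`, `H`, `W` and `Γ` occurs in both components, so its coefficient combines a term in
`C` with a term in `D`; these combinations produce the cross terms of `variance_identity`. -/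
lemma frob_psi (ξ : State n m L J) (C : BlockRow n L J) (D : BlockRow m L J)
    (p : PsiNoise n m L J Z) :
    let Θ := alg.Theta (fun i => mix.cls (lab i)) ξ
    let Ω := alg.Omega (fun i => mix.cls (lab i)) ξ
    let T := psi mix alg fac z lab p.1 p.2.1 p.2.2.1 p.2.2.2 ξ
    frob C T.1 + frob D T.2 =
      (∑ k, frob ((1 / √(m : ℝ)) • (mix.sqrtCov k * C * (fac.Aω lab k Ω)ᵀ
          + mix.sqrtCov k * Θ * (adjOmega mix fac lab k Ω D)ᵀ)) (p.1 k)) +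
        (frob (coefH mix fac alg lab ξ C D) p.2.1 +
          (∑ k, frob ((σ * (1 / √(m : ℝ))) • (adjTheta mix fac k Θ C
              + (adjOmega mix fac lab k Ω D)ᵀ)) (p.2.2.1 k) +
            ∑ k, frob ((z * (1 / √(m : ℝ))) • coefGamma mix fac lab k Θ C Ω D) (p.2.2.2 k))) := by
  intro Θ Ω T
  classical
  have h1 : T.1 = ∑ k, mix.sqrtCov k * ((1 / √(m : ℝ)) • p.1 k) * fac.Aω lab k Ω
      + ∑ k, mix.cov k * Θ * (fac.Aθ k Θ)⁻¹ *
        blockUpper ((1 / (m : ℝ)) • ((rowsOf lab k p.2.1)ᵀ * rowsOf lab k Ω)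
            + (1 / √(m : ℝ)) • (σ • p.2.2.1 k + z • (p.2.2.2 k * fac.Aω lab k Ω))) := by
    simp only [T, psi]
    congr!
  have h2 : T.2 = assemble lab fun k => rowsOf lab k p.2.1 * fac.Aθ k Θ
        + rowsOf lab k Ω * (fac.Aω lab k Ω)⁻¹ *
          blockStrictUpper ((1 / √(m : ℝ)) •
            ((p.1 k)ᵀ * mix.sqrtCov k * Θ + σ • (p.2.2.1 k)ᵀ
              + z • ((p.2.2.2 k)ᵀ * fac.Aθ k Θ))) := rfl
  have e1 : ∀ k, frob C (mix.sqrtCov k * p.1 k * fac.Aω lab k Ω) =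
      frob (mix.sqrtCov k * C * (fac.Aω lab k Ω)ᵀ) (p.1 k) := fun k => by
    rw [frob_mul_right, transpose_transpose, frob_mul_left, mix.transpose_sqrtCov, Matrix.mul_assoc]
  have e2 : ∀ k, frob (adjOmega mix fac lab k Ω D) ((p.1 k)ᵀ * mix.sqrtCov k * Θ) =
      frob (mix.sqrtCov k * Θ * (adjOmega mix fac lab k Ω D)ᵀ) (p.1 k) := fun k => by
    rw [← frob_transpose, frob_mul_left]
    simp [Matrix.mul_assoc, mix.transpose_sqrtCov]
  have e3 : ∀ k, frob (adjTheta mix fac k Θ C) ((rowsOf lab k p.2.1)ᵀ * rowsOf lab k Ω) =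
      frob (rowsOf lab k Ω * (adjTheta mix fac k Θ C)ᵀ) (rowsOf lab k p.2.1) := fun k => by
    rw [← frob_transpose, frob_mul_left]
    simp
  have e4 : ∀ k, frob (rowsOf lab k D) (rowsOf lab k p.2.1 * fac.Aθ k Θ) =
      frob (rowsOf lab k D * (fac.Aθ k Θ)ᵀ) (rowsOf lab k p.2.1) := fun k => by
    rw [frob_mul_right, transpose_transpose]
  have e5 : ∀ k, frob (adjOmega mix fac lab k Ω D) (p.2.2.1 k)ᵀ =
      frob (adjOmega mix fac lab k Ω D)ᵀ (p.2.2.1 k) := fun k => by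
    rw [← frob_transpose, transpose_transpose]
  have e6 : frob (coefH mix fac alg lab ξ C D) p.2.1 = ∑ k, (frob (rowsOf lab k D * (fac.Aθ k Θ)ᵀ)
      (rowsOf lab k p.2.1) + (1 / (m : ℝ)) * frob (rowsOf lab k Ω * (adjTheta mix fac k Θ C)ᵀ)
        (rowsOf lab k p.2.1)) := by
    rw [frob_eq_sum_rowsOf lab, coefH]
    simp only [rowsOf_assemble, frob_add_left, frob_smul_left]
    rfl
  rw [h1, h2, e6]
  simp only [Matrix.mul_smul, Matrix.smul_mul, frob_add_right, frob_add_left, frob_smul_right,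
    frob_smul_left, frob_sum_right, frob_assemble, frob_mul_blockUpper, frob_mul_blockStrictUpper,
    frob_coefGamma, e1, e2, e3, e4, e5]
  simp only [← Finset.sum_add_distrib]
  refine Finset.sum_congr rfl fun k _ => ?_
  ring

lemma hasGaussChar_phiPert (ξ : State n m L J) (C : BlockRow n L J) (D : BlockRow m L J) :
    let Θ := alg.Theta (fun i => mix.cls (lab i)) ξ
    let Ω := alg.Omega (fun i => mix.cls (lab i)) ξ
    let B := (1 / (m : ℝ)) • (C * Ωᵀ) + Θ * Dᵀ
    HasGaussChar (phiLaw mix lab L J)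
      (fun p => frob C (phiPert mix alg fac z lab p.1 p.2.1 p.2.2.1 p.2.2.2 ξ).1
        + frob D (phiPert mix alg fac z lab p.1 p.2.1 p.2.2.1 p.2.2.2 ξ).2) 0
      (∑ i, B.col i ⬝ᵥ (mix.cov (lab i)).mulVec (B.col i) +
        (∑ k, frob ((σ * (1 / √(m : ℝ))) • (mix.sqrtCov k * C))
            ((σ * (1 / √(m : ℝ))) • (mix.sqrtCov k * C)) +
          (frob (σ • D) (σ • D) +
            ∑ k, frob (√((1 + z ^ 2) / (m : ℝ)) • coefGamma mix fac lab k Θ C Ω D)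
              (√((1 + z ^ 2) / (m : ℝ)) • coefGamma mix fac lab k Θ C Ω D)))) := by
  intro Θ Ω B
  have h := (HasGaussChar.pi fun i => hasGaussChar_multivariateGaussian (mix.mean (lab i))
    (mix.posSemidef_cov (lab i)) (B.col i)).prod
    ((HasGaussChar.pi fun k => hasGaussChar_stdGaussianMatrix
      ((σ * (1 / √(m : ℝ))) • (mix.sqrtCov k * C))).prod
    ((hasGaussChar_stdGaussianMatrix (σ • D)).prod
      (HasGaussChar.pi fun k => hasGaussChar_stdGaussianMatrix
        (√((1 + z ^ 2) / (m : ℝ)) • coefGamma mix fac lab k Θ C Ω D))))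
  simp only [add_zero] at h
  have e := funext fun p => frob_phiPert mix fac alg z lab ξ C D p
  exact e ▸ h

lemma hasGaussChar_psi (ξ : State n m L J) (C : BlockRow n L J) (D : BlockRow m L J) :
    let Θ := alg.Theta (fun i => mix.cls (lab i)) ξ
    let Ω := alg.Omega (fun i => mix.cls (lab i)) ξ
    let G := fun k => (1 / √(m : ℝ)) • (mix.sqrtCov k * C * (fac.Aω lab k Ω)ᵀ
          + mix.sqrtCov k * Θ * (adjOmega mix fac lab k Ω D)ᵀ)
    let H := coefH mix fac alg lab ξ C D
    let W := fun k => (σ * (1 / √(m : ℝ))) • (adjTheta mix fac k Θ C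
              + (adjOmega mix fac lab k Ω D)ᵀ)
    let Γ := fun k => (z * (1 / √(m : ℝ))) • coefGamma mix fac lab k Θ C Ω D
    HasGaussChar (psiLaw n m L J Z)
      (fun p => frob C (psi mix alg fac z lab p.1 p.2.1 p.2.2.1 p.2.2.2 ξ).1
        + frob D (psi mix alg fac z lab p.1 p.2.1 p.2.2.1 p.2.2.2 ξ).2) 0
      (∑ k, frob (G k) (G k) + (frob H H + (∑ k, frob (W k) (W k) + ∑ k, frob (Γ k) (Γ k)))) := by
  intro Θ Ω G H W Γ
  have h := (HasGaussChar.pi fun k => hasGaussChar_stdGaussianMatrix (G k)).prod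
    ((hasGaussChar_stdGaussianMatrix H).prod
      ((HasGaussChar.pi fun k => hasGaussChar_stdGaussianMatrix (W k)).prod
        (HasGaussChar.pi fun k => hasGaussChar_stdGaussianMatrix (Γ k))))
  simp only [add_zero] at h
  have e := funext fun p => frob_psi mix fac alg z lab ξ C D p
  exact e ▸ h

lemma sum_col_dotProduct_cov_mulVec (B : Matrix (Fin n) (Fin m) ℝ) :
    open scoped Classical in
    ∑ i, B.col i ⬝ᵥ (mix.cov (lab i)).mulVec (B.col i) =
      ∑ k, frob (B.submatrix id (Subtype.val : {i // lab i = k} → Fin m))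
        (mix.cov k * B.submatrix id (Subtype.val : {i // lab i = k} → Fin m)) := by
  classical
  rw [sum_labels lab]
  refine Finset.sum_congr rfl fun k _ => ?_
  rw [frob_eq_sum, Finset.sum_comm]
  refine Finset.sum_congr (by congr!) fun i _ => ?_
  obtain ⟨i, rfl⟩ := i
  rfl

/-- For a deterministic state, the values of the two processes have the same law. -/
theorem map_phiPert_eq_map_psi (hm : 0 < m) (hσ : 0 < σ) (ξ : State n m L J) :
    (phiLaw mix lab L J).map (fun p => phiPert mix alg fac z lab p.1 p.2.1 p.2.2.1 p.2.2.2 ξ) =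
      (psiLaw n m L J Z).map (fun p => psi mix alg fac z lab p.1 p.2.1 p.2.2.1 p.2.2.2 ξ) := by
  classical
  have hmφ := measurable_phiPert alg mix fac z lab hσ ξ
  have hmψ := measurable_psi alg mix fac z lab hσ ξ
  refine state_measure_ext fun C D => ?_
  have hfr : Measurable fun ξ : State n m L J =>
      Complex.exp ((frob C ξ.1 + frob D ξ.2 : ℝ) * Complex.I) := by
    have h1 : Continuous fun ξ : State n m L J => frob C ξ.1 + frob D ξ.2 :=
      ((continuous_const.matrix_mul continuous_fst).matrix_trace).add
        ((continuous_const.matrix_mul continuous_snd).matrix_trace)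
    exact (by fun_prop : Continuous fun ξ : State n m L J =>
      Complex.exp ((frob C ξ.1 + frob D ξ.2 : ℝ) * Complex.I)).measurable
  rw [integral_map hmφ.aemeasurable hfr.aestronglyMeasurable,
    integral_map hmψ.aemeasurable hfr.aestronglyMeasurable]
  refine (hasGaussChar_phiPert mix fac alg z lab ξ C D).trans
    (Eq.trans ?_ (hasGaussChar_psi mix fac alg z lab ξ C D).symm)
  -- Both sides are characteristic functions of centred Gaussians, so only the variances are left to
  -- compare.
  congr 4
  set Θ := alg.Theta (fun i => mix.cls (lab i)) ξ
  set Ω := alg.Omega (fun i => mix.cls (lab i)) ξ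
  have hm0 : (0 : ℝ) < m := by exact_mod_cast hm
  have hs : (1 : ℝ) / m = (1 / √(m : ℝ)) ^ 2 := by
    rw [div_pow, Real.sq_sqrt hm0.le, one_pow]
  have hc : √((1 + z ^ 2) / (m : ℝ)) ^ 2 = (1 + z ^ 2) * (1 / √(m : ℝ)) ^ 2 := by
    rw [Real.sq_sqrt (by positivity), ← hs]; ring
  rw [sum_col_dotProduct_cov_mulVec, frob_eq_sum_rowsOf lab (σ • D),
    frob_eq_sum_rowsOf lab (coefH mix fac alg lab ξ C D)]
  simp only [← Finset.sum_add_distrib]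
  refine Finset.sum_congr rfl fun k _ => ?_
  have hdA := fac.isUnit_det_Aθ hσ k Θ
  have hdB := fac.isUnit_det_Aω hσ lab k Ω
  -- Here `α` and `β` are the adjoint coefficients before truncation; their block upper and strictly
  -- block upper parts are `adjTheta` and `adjOmega`. The last two side goals cancel `A⁻¹` against
  -- `A`.
  have key := variance_identity (1 / √(m : ℝ)) σ z (mix.transpose_sqrtCov k)
    (mix.sqrtCov_mul_self k) (Θ := Θ) (C := C) (Ω := rowsOf lab k Ω) (D := rowsOf lab k D)
    (A := fac.Aθ k Θ) (B := fac.Aω lab k Ω)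
    (α := (mix.cov k * Θ * (fac.Aθ k Θ)⁻¹)ᵀ * C)
    (β := (rowsOf lab k Ω * (fac.Aω lab k Ω)⁻¹)ᵀ * rowsOf lab k D)
    (fac.blockTriangular_θ k Θ) (fac.blockTriangular_ω lab k Ω) (fac.factor_θ k Θ)
    (by rw [fac.factor_ω, overlapOmega, hs]) (by
      have hcov : (mix.cov k)ᵀ = mix.cov k := by
        simpa using (mix.posSemidef_cov k).isHermitian.eq
      rw [← Matrix.mul_assoc, ← transpose_mul, Matrix.mul_assoc, Matrix.nonsing_inv_mul _ hdA,
        Matrix.mul_one, transpose_mul, hcov]) (by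
      rw [← Matrix.mul_assoc, ← transpose_mul, Matrix.mul_assoc, Matrix.nonsing_inv_mul _ hdB,
        Matrix.mul_one])
  rw [coefH, rowsOf_assemble]
  simp only [frob_self_smul, hc, hs]
  have hD : frob (rowsOf lab k (σ • D)) (rowsOf lab k (σ • D)) =
      σ ^ 2 * frob (rowsOf lab k D) (rowsOf lab k D) := frob_self_smul σ (rowsOf lab k D)
  rw [hD]
  refine Eq.trans ?_ (key.trans ?_)
  · simp only [← add_assoc]
    rfl
  · simp only [← add_assoc]
    rfl

end FixedState

/-! ### Conditioning on a finite label. -/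

section Conditioning

variable {S Λ E E' F : Type*} [MeasurableSpace S] [MeasurableSpace Λ] [MeasurableSpace E]
  [MeasurableSpace E'] [MeasurableSpace F] {P : Measure S}

/-- Restricting to an event of `f` does not affect the independent `g`. In the application `f` is
the labelled data, `A` fixes the labels, `h` forgets them, and `g` is the added noise. -/
lemma map_restrict_prodMk_of_indepFun [IsFiniteMeasure P] {f : S → E} {g : S → E'} (hfg : IndepFun f g P)
    (hf : AEMeasurable f P) (hg : AEMeasurable g P) {A : Set E} (hA : MeasurableSet A)
    {h : E → F} (hh : Measurable h) :
    (P.restrict (f ⁻¹' A)).map (fun s => (h (f s), g s)) =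
      ((P.restrict (f ⁻¹' A)).map (fun s => h (f s))).prod (P.map g) := by
  have hhf : AEMeasurable (fun s => h (f s)) P := hh.comp_aemeasurable hf
  have hfA : NullMeasurableSet (f ⁻¹' A) P := hf.nullMeasurable hA
  refine (Measure.prod_eq fun s t hs ht => ?_).symm
  rw [Measure.map_apply_of_aemeasurable (hhf.restrict.prodMk hg.restrict) (hs.prod ht),
    Measure.map_apply_of_aemeasurable hhf.restrict hs, Measure.map_apply_of_aemeasurable hg ht,
    Measure.restrict_apply₀' hfA, Measure.restrict_apply₀' hfA]
  have e1 : (fun s => (h (f s), g s)) ⁻¹' (s ×ˢ t) ∩ f ⁻¹' A = f ⁻¹' (h ⁻¹' s ∩ A) ∩ g ⁻¹' t := by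
    ext ω; simp only [Set.mem_inter_iff, Set.mem_preimage, Set.mem_prod]; tauto
  rw [e1, hfg.measure_inter_preimage_eq_mul _ _ ((hh hs).inter hA) ht]
  rfl

lemma map_restrict_of_indepFun {f : S → E} {g : S → E'} (hfg : IndepFun f g P)
    (hf : AEMeasurable f P) (hg : AEMeasurable g P) {A : Set E} (hA : MeasurableSet A) :
    (P.restrict (f ⁻¹' A)).map g = P (f ⁻¹' A) • P.map g := by
  ext t ht
  rw [Measure.map_apply_of_aemeasurable hg.restrict ht, Measure.smul_apply,
    Measure.map_apply_of_aemeasurable hg ht, Measure.restrict_apply₀' (hf.nullMeasurable hA),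
    Set.inter_comm, hfg.measure_inter_preimage_eq_mul _ _ hA ht, smul_eq_mul]

lemma aemeasurable_of_labels [Countable Λ] [MeasurableSingletonClass Λ] {ζ : S → Λ}
    (hζ : AEMeasurable ζ P) {N : S → E} (hN : AEMeasurable N P) {g : Λ → E → F}
    (hg : ∀ k, Measurable (g k)) : AEMeasurable (fun s => g (ζ s) (N s)) P :=
  (measurable_from_prod_countable_right (f := fun q : Λ × E => g q.1 q.2) hg).comp_aemeasurable
    (hζ.prodMk hN)

/-- The law of a function of a finite label and of a random variable with known conditional laws. -/
lemma map_eq_sum_of_labels [Fintype Λ] [MeasurableSingletonClass Λ] {ζ : S → Λ}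
    (hζ : AEMeasurable ζ P) {N : S → E} (hN : AEMeasurable N P) {κ : Λ → Measure E}
    (hκ : ∀ k, (P.restrict (ζ ⁻¹' {k})).map N = P (ζ ⁻¹' {k}) • κ k) {g : Λ → E → F}
    (hg : ∀ k, Measurable (g k)) :
    P.map (fun s => g (ζ s) (N s)) = ∑ k, P (ζ ⁻¹' {k}) • (κ k).map (g k) := by
  have hgm : AEMeasurable (fun s => g (ζ s) (N s)) P := aemeasurable_of_labels hζ hN hg
  have hA : ∀ k, NullMeasurableSet (ζ ⁻¹' {k}) P :=
    fun k => hζ.nullMeasurable (measurableSet_singleton k)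
  -- The level sets of the label form a finite partition, and on each of them `g (ζ s)` is a fixed
  -- measurable function.
  have hP : P = ∑ k, P.restrict (ζ ⁻¹' {k}) := by
    rw [← Measure.sum_fintype, ← Measure.restrict_iUnion_ae _ hA, ← Set.preimage_iUnion,
      Set.iUnion_of_singleton, Set.preimage_univ, Measure.restrict_univ]
    intro k k' hk
    exact (Disjoint.preimage _ (Set.disjoint_singleton.2 hk)).aedisjoint
  ext B hB
  rw [Measure.map_apply_of_aemeasurable hgm hB]
  conv_lhs => rw [hP]
  rw [Measure.finsetSum_apply, Measure.finsetSum_apply]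
  refine Finset.sum_congr rfl fun k _ => ?_
  rw [Measure.smul_apply, Measure.map_apply (hg k) hB, ← Measure.smul_apply, ← hκ k,
    Measure.map_apply_of_aemeasurable hN.restrict (hg k hB), Measure.restrict_apply₀' (hA k),
    Measure.restrict_apply₀' (hA k)]
  congr 1
  ext s
  simp only [Set.mem_inter_iff, Set.mem_preimage, Set.mem_singleton_iff]
  exact and_congr_left fun h => by rw [h]

end Conditioning

/-! ### The conditional law of the samples given the labels. -/

section Sample

variable {n m : ℕ} {Z Y : Type*} [MeasurableSpace Z] [MeasurableSingletonClass Z]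
  {mix : Mixture n Z Y} {S : Type*} [MeasurableSpace S] {P : Measure S} [IsProbabilityMeasure P]
  {ζ : Fin m → S → Z} {x : Fin m → S → EuclideanSpace ℝ (Fin n)}

lemma IsMixtureSample.measure_inter_preimage (h : IsMixtureSample mix P ζ x) (i : Fin m) (k : Z)
    {s : Set (EuclideanSpace ℝ (Fin n))} (hs : MeasurableSet s) :
    P (ζ i ⁻¹' {k} ∩ x i ⁻¹' s) =
      P (ζ i ⁻¹' {k}) * multivariateGaussian (mix.mean k) (mix.cov k) s := by
  have hk : MeasurableSet (ζ i ⁻¹' {k}) := h.measurable_label i (measurableSet_singleton k)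
  -- For a label of probability zero nothing is assumed about the conditional law, but both sides
  -- vanish.
  by_cases h0 : P (ζ i ⁻¹' {k}) = 0
  · rw [h0, zero_mul]
    exact measure_mono_null Set.inter_subset_left h0
  · rw [← (h.gaussian i k h0).map_eq, Measure.map_apply (h.measurable_sample i) hs,
      ProbabilityTheory.cond_apply hk, ← mul_assoc,
      ENNReal.mul_inv_cancel h0 (measure_ne_top _ _), one_mul]

/-- Given the latent labels, the samples are independent Gaussian vectors. -/
lemma IsMixtureSample.map_restrict (h : IsMixtureSample mix P ζ x) (lab : Fin m → Z) :
    (P.restrict ((fun s i => ζ i s) ⁻¹' {lab})).map (fun s i => x i s) =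
      P ((fun s i => ζ i s) ⁻¹' {lab}) •
        Measure.pi fun i => multivariateGaussian (mix.mean (lab i)) (mix.cov (lab i)) := by
  have hx : Measurable fun s i => x i s := measurable_pi_lambda _ h.measurable_sample
  have hprod : ∀ s : Fin m → Set (EuclideanSpace ℝ (Fin n)), (∀ i, MeasurableSet (s i)) →
      P ((fun ω i => x i ω) ⁻¹' Set.univ.pi s ∩ (fun ω i => ζ i ω) ⁻¹' {lab}) =
        ∏ i, P (ζ i ⁻¹' {lab i}) *
          multivariateGaussian (mix.mean (lab i)) (mix.cov (lab i)) (s i) := by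
    intro s hs
    have e1 : (fun ω i => x i ω) ⁻¹' Set.univ.pi s ∩ (fun ω i => ζ i ω) ⁻¹' {lab} =
        ⋂ i ∈ Finset.univ, (fun ω => (ζ i ω, x i ω)) ⁻¹' ({lab i} ×ˢ s i) := by
      ext ω
      simp only [Set.mem_inter_iff, Set.mem_preimage, Set.mem_univ_pi, Set.mem_singleton_iff,
        funext_iff, Finset.mem_univ, Set.iInter_true, Set.mem_iInter, Set.mem_prod]
      exact and_comm.trans forall_and.symm
    rw [e1, h.indep.measure_inter_preimage_eq_mul Finset.univ
      fun i _ => (measurableSet_singleton (lab i)).prod (hs i)]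
    exact Finset.prod_congr rfl fun i _ => h.measure_inter_preimage i (lab i) (hs i)
  have hA : MeasurableSet ((fun s i => ζ i s) ⁻¹' {lab}) :=
    measurable_pi_lambda _ h.measurable_label (measurableSet_singleton lab)
  have hA0 : P ((fun s i => ζ i s) ⁻¹' {lab}) = ∏ i, P (ζ i ⁻¹' {lab i}) := by
    simpa using hprod (fun _ => Set.univ) fun _ => MeasurableSet.univ
  have hfin : ∀ i, IsFiniteMeasure (P (ζ i ⁻¹' {lab i}) •
      multivariateGaussian (mix.mean (lab i)) (mix.cov (lab i))) :=
    fun i => Measure.smul_finite _ (measure_ne_top _ _)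
  -- The probability of the label vector factorizes, so its factors can be absorbed into the
  -- marginals; both equalities are then checked on boxes.
  trans Measure.pi fun i => P (ζ i ⁻¹' {lab i}) •
      multivariateGaussian (mix.mean (lab i)) (mix.cov (lab i))
  · refine (Measure.pi_eq fun s hs => ?_).symm
    rw [Measure.map_apply hx (MeasurableSet.univ_pi hs), Measure.restrict_apply' hA, hprod s hs]
    rfl
  · refine Measure.pi_eq fun s hs => ?_
    rw [Measure.smul_apply, Measure.pi_pi, hA0, smul_eq_mul, ← Finset.prod_mul_distrib]
    rfl

end Sample

/-! ### The solutions as fixed points, for given labels. -/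

section Solutions

variable {n m L J : ℕ} {Z Y : Type*} [Fintype Z] (mix : Mixture n Z Y) (alg : Algorithm n m L J Y)
  {σ : ℝ} (fac : Factors m L J mix σ) (z : ℝ)

/-- The map whose fixed point is the solution of `φ' + ρ₀ = 0`. -/
def phiStep (lab : Fin m → Z) (p : PhiNoise n m L J Z) (ξ : State n m L J) : State n m L J :=
  phiPert mix alg fac z lab p.1 p.2.1 p.2.2.1 p.2.2.2 ξ + drift mix alg lab ξ

/-- The map whose fixed point is the solution of `ψ + ρ₀ = 0`. -/
def psiStep (lab : Fin m → Z) (p : PsiNoise n m L J Z) (ξ : State n m L J) : State n m L J :=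
  psi mix alg fac z lab p.1 p.2.1 p.2.2.1 p.2.2.2 ξ + drift mix alg lab ξ

lemma isStateCausal_phiStep (hσ : 0 < σ) (lab : Fin m → Z) (p : PhiNoise n m L J Z) :
    IsStateCausal (phiStep mix alg fac z lab p) :=
  (isStateCausal_phiPert mix alg fac z lab hσ _ _ _ _).add (isStateCausal_matrix_mul mix alg lab _)

lemma isStateCausal_psiStep (hσ : 0 < σ) (lab : Fin m → Z) (p : PsiNoise n m L J Z) :
    IsStateCausal (psiStep mix alg fac z lab p) :=
  (isStateCausal_psi mix alg fac z lab hσ _ _ _ _).add (isStateCausal_matrix_mul mix alg lab _)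

lemma continuous_phiStep (hσ : 0 < σ) (lab : Fin m → Z) (p : PhiNoise n m L J Z) :
    Continuous (phiStep mix alg fac z lab p) := by
  have h : Continuous fun ξ : State n m L J => (p, ξ) := continuous_const.prodMk continuous_id
  exact ((continuous_phiPert alg mix fac z lab hσ).comp h).add (continuous_drift alg mix lab)

lemma measurable_add_state (ξ : State n m L J) : Measurable fun T : State n m L J => T + ξ :=
  (continuous_id.add continuous_const).measurable

lemma measurable_phiStep (hσ : 0 < σ) (lab : Fin m → Z) (ξ : State n m L J) :
    Measurable fun p : PhiNoise n m L J Z => phiStep mix alg fac z lab p ξ :=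
  (measurable_add_state (drift mix alg lab ξ)).comp (measurable_phiPert alg mix fac z lab hσ ξ)

lemma continuous_psiStep (hσ : 0 < σ) (lab : Fin m → Z) (p : PsiNoise n m L J Z) :
    Continuous (psiStep mix alg fac z lab p) := by
  have h : Continuous fun ξ : State n m L J => (p, ξ) := continuous_const.prodMk continuous_id
  exact ((continuous_psi alg mix fac z lab hσ).comp h).add (continuous_drift alg mix lab)

lemma measurable_psiStep (hσ : 0 < σ) (lab : Fin m → Z) (ξ : State n m L J) :
    Measurable fun p : PsiNoise n m L J Z => psiStep mix alg fac z lab p ξ :=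
  (measurable_add_state (drift mix alg lab ξ)).comp (measurable_psi alg mix fac z lab hσ ξ)

/-- Given the latent labels, the solutions of the two systems have the same law. -/
theorem map_stateFix_phiStep_eq (hm : 0 < m) (hσ : 0 < σ) (lab : Fin m → Z) :
    (phiLaw mix lab L J).map (fun p => stateFix (phiStep mix alg fac z lab p)) =
      (psiLaw n m L J Z).map (fun p => stateFix (psiStep mix alg fac z lab p)) := by
  refine map_stateFix_eq (isStateCausal_phiStep mix alg fac z hσ lab)
    (isStateCausal_psiStep mix alg fac z hσ lab) (continuous_phiStep mix alg fac z hσ lab)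
    (measurable_phiStep mix alg fac z hσ lab) (continuous_psiStep mix alg fac z hσ lab)
    (measurable_psiStep mix alg fac z hσ lab) fun ξ => ?_
  have hadd := measurable_add_state (drift mix alg lab ξ)
  have h := congrArg (Measure.map fun T => T + drift mix alg lab ξ)
    (map_phiPert_eq_map_psi mix fac alg z lab hm hσ ξ)
  rwa [Measure.map_map hadd (measurable_phiPert alg mix fac z lab hσ ξ),
    Measure.map_map hadd (measurable_psi alg mix fac z lab hσ ξ)] at h

end Solutions

end GMTraining

end

/-! ### The theorem, by averaging over the labels. -/

open GMTraining in
theorem theorem1 {n m L J : ℕ} (hm : 0 < m)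
    {Z Y : Type*} [Fintype Z] [MeasurableSpace Z] [MeasurableSingletonClass Z]
    (mix : Mixture n Z Y) (alg : Algorithm n m L J Y)
    {σ : ℝ} (hσ : 0 < σ) (z : ℝ) (fac : Factors m L J mix σ)
    -- randomness of the perturbed original dynamics
    {S : Type*} [MeasurableSpace S] (P : Measure S) [IsProbabilityMeasure P]
    (ζ : Fin m → S → Z) (x : Fin m → S → EuclideanSpace ℝ (Fin n))
    (hdata : IsMixtureSample mix P ζ x)
    (U : S → Z → BlockRow n L J) (V : S → BlockRow m L J) (Γ : S → Z → BlockSq L J)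
    (hnoise : HasLaw (fun s => (U s, V s, Γ s))
      ((Measure.pi fun _ : Z => stdGaussianMatrix (Fin n) (Fin L × Fin J)).prod
        ((stdGaussianMatrix (Fin m) (Fin L × Fin J)).prod
          (Measure.pi fun _ : Z => stdGaussianMatrix (Fin L × Fin J) (Fin L × Fin J)))) P)
    (hindep : IndepFun (fun s i => (ζ i s, x i s)) (fun s => (U s, V s, Γ s)) P)
    -- randomness of the alternative dynamics
    {S' : Type*} [MeasurableSpace S'] (P' : Measure S') [IsProbabilityMeasure P']
    (ζ' : Fin m → S' → Z)
    (hlabels : IdentDistrib (fun s i => ζ' i s) (fun s i => ζ i s) P' P)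
    (G : S' → Z → BlockRow n L J) (H : S' → BlockRow m L J) (W Γ' : S' → Z → BlockSq L J)
    (hnoise' : HasLaw (fun s => (G s, H s, W s, Γ' s))
      ((Measure.pi fun _ : Z => stdGaussianMatrix (Fin n) (Fin L × Fin J)).prod
        ((stdGaussianMatrix (Fin m) (Fin L × Fin J)).prod
          ((Measure.pi fun _ : Z => stdGaussianMatrix (Fin L × Fin J) (Fin L × Fin J)).prod
            (Measure.pi fun _ : Z => stdGaussianMatrix (Fin L × Fin J) (Fin L × Fin J))))) P')
    (hindep' : IndepFun (fun s i => ζ' i s) (fun s => (G s, H s, W s, Γ' s)) P') :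
    (∀ s, ∃! ξ : State n m L J,
      psi mix alg fac z (fun i => ζ' i s) (G s) (H s) (W s) (Γ' s) ξ
        + rhoZero mix alg (fun i => ζ' i s) ξ = 0) ∧
    (∀ s, ∃! ξ : State n m L J,
      phiPert mix alg fac z (fun i => ζ i s) (fun i => x i s) (U s) (V s) (Γ s) ξ
        + rhoZero mix alg (fun i => ζ i s) ξ = 0) ∧
    ∀ (ξψ : S' → State n m L J) (ξφ : S → State n m L J),
      (∀ s, psi mix alg fac z (fun i => ζ' i s) (G s) (H s) (W s) (Γ' s) (ξψ s)
        + rhoZero mix alg (fun i => ζ' i s) (ξψ s) = 0) →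
      (∀ s, phiPert mix alg fac z (fun i => ζ i s) (fun i => x i s) (U s) (V s) (Γ s) (ξφ s)
        + rhoZero mix alg (fun i => ζ i s) (ξφ s) = 0) →
      IdentDistrib ξψ ξφ P' P ∧
      ∀ h : State n m L J → ℝ, Measurable h →
        (Integrable (fun s => h (ξψ s)) P' ↔ Integrable (fun s => h (ξφ s)) P) ∧
        ∫ s, h (ξψ s) ∂P' = ∫ s, h (ξφ s) ∂P := by
  set ζv : S → Fin m → Z := fun s i => ζ i s with hζv
  set ζv' : S' → Fin m → Z := fun s i => ζ' i s with hζv'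
  set N : S → PhiNoise n m L J Z := fun s => (fun i => x i s, U s, V s, Γ s) with hN
  set N' : S' → PsiNoise n m L J Z := fun s => (G s, H s, W s, Γ' s) with hN'
  have hφc := isStateCausal_phiStep mix alg fac z hσ
  have hψc := isStateCausal_psiStep mix alg fac z hσ
  have hφiff : ∀ s ξ, phiPert mix alg fac z (fun i => ζ i s) (fun i => x i s) (U s) (V s) (Γ s) ξ
      + rhoZero mix alg (fun i => ζ i s) ξ = 0 ↔ phiStep mix alg fac z (ζv s) (N s) ξ = ξ :=
    fun s ξ => add_rhoZero_eq_zero_iff mix alg _ _ ξ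
  have hψiff : ∀ s ξ, psi mix alg fac z (fun i => ζ' i s) (G s) (H s) (W s) (Γ' s) ξ
      + rhoZero mix alg (fun i => ζ' i s) ξ = 0 ↔ psiStep mix alg fac z (ζv' s) (N' s) ξ = ξ :=
    fun s ξ => add_rhoZero_eq_zero_iff mix alg _ _ ξ
  refine ⟨fun s => ⟨stateFix (psiStep mix alg fac z (ζv' s) (N' s)),
      (hψiff s _).2 (hψc _ _).map_stateFix, fun ξ hξ => (hψc _ _).eq_stateFix ((hψiff s ξ).1 hξ)⟩,
    fun s => ⟨stateFix (phiStep mix alg fac z (ζv s) (N s)),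
      (hφiff s _).2 (hφc _ _).map_stateFix, fun ξ hξ => (hφc _ _).eq_stateFix ((hφiff s ξ).1 hξ)⟩,
    fun ξψ ξφ hξψ hξφ => ?_⟩
  -- By uniqueness any family of solutions is the explicit fixed point, so its measurability need
  -- not be assumed.
  obtain rfl : ξψ = fun s => stateFix (psiStep mix alg fac z (ζv' s) (N' s)) :=
    funext fun s => (hψc _ _).eq_stateFix ((hψiff s _).1 (hξψ s))
  obtain rfl : ξφ = fun s => stateFix (phiStep mix alg fac z (ζv s) (N s)) :=
    funext fun s => (hφc _ _).eq_stateFix ((hφiff s _).1 (hξφ s))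
  have hζ : AEMeasurable ζv P := hlabels.aemeasurable_snd
  have hζ' : AEMeasurable ζv' P' := hlabels.aemeasurable_fst
  have hdm : Measurable fun s i => (ζ i s, x i s) := measurable_pi_lambda _ fun i =>
    (hdata.measurable_label i).prodMk (hdata.measurable_sample i)
  have hsnd : Measurable fun (d : Fin m → Z × EuclideanSpace ℝ (Fin n)) i => (d i).2 :=
    measurable_pi_lambda _ fun i => measurable_snd.comp (measurable_pi_apply i)
  have hfst : Measurable fun (d : Fin m → Z × EuclideanSpace ℝ (Fin n)) i => (d i).1 :=
    measurable_pi_lambda _ fun i => measurable_fst.comp (measurable_pi_apply i)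
  have hNm : AEMeasurable N P := (hsnd.comp hdm).aemeasurable.prodMk hnoise.aemeasurable
  have hκ : ∀ lab, (P.restrict (ζv ⁻¹' {lab})).map N =
      P (ζv ⁻¹' {lab}) • phiLaw mix lab L J := fun lab => by
    have h1 := map_restrict_prodMk_of_indepFun hindep hdm.aemeasurable hnoise.aemeasurable
      (hfst (measurableSet_singleton lab)) hsnd
    have h2 := hdata.map_restrict lab
    rw [hnoise.map_eq] at h1
    refine h1.trans ?_
    rw [phiLaw, ← Measure.prod_smul_left, ← h2]
    rfl
  have hκ' : ∀ lab, (P'.restrict (ζv' ⁻¹' {lab})).map N' =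
      P' (ζv' ⁻¹' {lab}) • psiLaw n m L J Z := fun lab => by
    rw [map_restrict_of_indepFun hindep' hζ' hnoise'.aemeasurable (measurableSet_singleton lab),
      hnoise'.map_eq, psiLaw]
  have hφm := fun lab => measurable_stateFix (continuous_phiStep mix alg fac z hσ lab)
    (measurable_phiStep mix alg fac z hσ lab)
  have hψm := fun lab => measurable_stateFix (continuous_psiStep mix alg fac z hσ lab)
    (measurable_psiStep mix alg fac z hσ lab)
  have hid : IdentDistrib (fun s => stateFix (psiStep mix alg fac z (ζv' s) (N' s)))
      (fun s => stateFix (phiStep mix alg fac z (ζv s) (N s))) P' P := by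
    refine ⟨aemeasurable_of_labels hζ' hnoise'.aemeasurable hψm,
      aemeasurable_of_labels hζ hNm hφm, ?_⟩
    -- Both laws are mixtures over the label vector; the conditional laws agree by
    -- `map_stateFix_phiStep_eq` and the weights by `hlabels`.
    rw [map_eq_sum_of_labels hζ' hnoise'.aemeasurable hκ' hψm,
      map_eq_sum_of_labels hζ hNm hκ hφm]
    refine Finset.sum_congr rfl fun lab _ => ?_
    rw [map_stateFix_phiStep_eq mix alg fac z hm hσ lab,
      hlabels.measure_mem_eq (measurableSet_singleton lab)]
  exact ⟨hid, fun h hh => ⟨(hid.comp hh).integrable_iff, (hid.comp hh).integral_eq⟩⟩
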